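/- Let $p\ge 5$ be a prime and let $T$ be the $p$-regular rooted tree, whose vertices are the finite words over $\{1,\dots,p\}$. Let $a\in\operatorname{Aut}T$ be the automorphism that permutes the $p$ subtrees rooted at the first level according to the cycle $(1\,2\,\dots\,p)$, let $b\in\operatorname{Aut}T$ be the automorphism that fixes the first level and is defined recursively by $b=(a,\dots,a,b)$ (it acts as $a$ on each of the first $p-1$ first-level subtrees and as $b$ on the last one), and let $\mathcal G=\langle a,b\rangle\le\operatorname{Aut}T$ be the GGS-group with constant defining vector. Write $\mathrm{st}_{\mathcal G}(n)$ for the subgroup of elements of $\mathcal G$ that fix every vertex of level $n$. For a class $\mathcal C$ of finite groups, say that $\mathcal G$ has the $\mathcal C$-congruence subgroup property ($\mathcal C$-CSP) if every normal subgroup $N\trianglelefteq\mathcal G$ with $\mathcal G/N\in\mathcal C$ contains $\mathrm{st}_{\mathcal G}(n)$ for some $n$; the $p$-CSP is the case where $\mathcal C$ consists of all finite $p$-groups, and the CSP is the case where $\mathcal C$ consists of all finite groups. Then: 1. $\mathcal G$ has the $p$-CSP. Moreover all quotients $\mathcal G/\mathrm{st}_{\mathcal G}(n)$ are finite $p$-groups,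 and the canonical homomorphism from the pro-$p$ completion $\varprojlim_N \mathcal G/N$ (over all $N\trianglelefteq\mathcal G$ with $\mathcal G/N$ a finite $p$-group) to the congruence completion $\varprojlim_n\mathcal G/\mathrm{st}_{\mathcal G}(n)$ is bijective. 2. $\mathcal G$ does not have the CSP. -/

import Mathlib

/-! ### The regular rooted tree and its automorphisms -/

/-- The automorphism group of the rooted tree whose vertices are the finite words over `X`: the
root is the empty word, the words of length `n` form level `n`, and the subtree rooted at `u`
consists of the words with prefix `u`. An automorphism is a permutation of the vertices that
preserves levels and the prefix relation. -/
def treeAut (X : Type) : Subgroup (Equiv.Perm (List X)) where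
  carrier := {g | (∀ v, (g v).length = v.length) ∧ ∀ u v, g u <+: g v ↔ u <+: v}
  one_mem' := by simp
  mul_mem' := by
    rintro g h ⟨hg, hg'⟩ ⟨hh, hh'⟩
    exact ⟨fun v => by simp [hg, hh], fun u v => by simp [hg', hh']⟩
  inv_mem' := by
    rintro g ⟨hg, hg'⟩
    refine ⟨fun v => ?_, fun u v => ?_⟩
    · rw [← hg (g⁻¹ v)]; simp
    · rw [← hg' (g⁻¹ u)]; simp

/-- The `n`-th level stabilizer `st_G(n)` of a group `G` of tree automorphisms: the elements of `G`
that fix every vertex of level `n`. -/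
def levelStabilizer {X : Type} (G : Subgroup (treeAut X)) (n : ℕ) : Subgroup G where
  carrier := {g | ∀ v : List X, v.length = n → (g : treeAut X).1 v = v}
  one_mem' := by simp
  mul_mem' := by
    intro g h hg hh v hv
    have h1 := hh v hv
    have h2 := hg v hv
    simp [h1, h2]
  inv_mem' := by
    intro g hg v hv
    have h1 := hg v hv
    simp [Equiv.symm_apply_eq, h1]

instance levelStabilizer_normal {X : Type} (G : Subgroup (treeAut X)) (n : ℕ) :
    (levelStabilizer G n).Normal where
  conj_mem := by
    intro g hg k v hv
    have h1 : (((k⁻¹ : G) : treeAut X).1 v).length = n := by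
      rw [((k⁻¹ : G) : treeAut X).2.1, hv]
    have h2 := hg _ h1
    change (k : treeAut X).1 ((g : treeAut X).1 (((k⁻¹ : G) : treeAut X).1 v)) = v
    rw [h2]
    simp

/-! ### The congruence subgroup property with respect to a class of groups -/

/-- A class of groups. -/
abbrev GroupClass := (Q : Type) → [Group Q] → Prop

/-- The class of all finite groups. -/
def finiteGroups : GroupClass := fun Q _ => Finite Q

/-- The class of all finite `p`-groups. -/
def finitePGroups (p : ℕ) : GroupClass := fun Q _ => Finite Q ∧ IsPGroup p Q

/-- `G` has the `C`-congruence subgroup property: every normal subgroup `N` of `G` with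
`G / N ∈ C` contains some level stabilizer of `G`. -/
def HasCSP {X : Type} (C : GroupClass) (G : Subgroup (treeAut X)) : Prop :=
  ∀ (N : Subgroup G) [N.Normal], C (G ⧸ N) → ∃ n : ℕ, levelStabilizer G n ≤ N

/-! ### Pro-`C` completion and congruence completion -/

/-- The inverse limit of the quotients `G / N i`, with respect to the projections
`G / N i → G / N j` for `N i ≤ N j`. -/
def quotientLimit {G : Type} [Group G] {ι : Type} (N : ι → Subgroup G) [∀ i, (N i).Normal] :
    Subgroup (∀ i, G ⧸ N i) where
  carrier := {x | ∀ i j (h : N i ≤ N j),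
    QuotientGroup.map (N i) (N j) (MonoidHom.id G) h (x i) = x j}
  one_mem' := by intro i j h; simp
  mul_mem' := by
    intro x y hx hy i j h
    simp [hx i j h, hy i j h]
  inv_mem' := by
    intro x hx i j h
    simp [hx i j h]

/-- The normal subgroups `N` of `G` with `G / N ∈ C`. -/
structure ClassSubgroup (C : GroupClass) (G : Type) [Group G] where
  toSubgroup : Subgroup G
  normal : toSubgroup.Normal
  quotient_mem : C (G ⧸ toSubgroup)

instance ClassSubgroup.instNormal {C : GroupClass} {G : Type} [Group G] (N : ClassSubgroup C G) :
    N.toSubgroup.Normal := N.normal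

/-- The pro-`C` completion: the inverse limit of all quotients of `G` that lie in `C`. -/
abbrev proCompletion (C : GroupClass) (G : Type) [Group G] :=
  quotientLimit (fun N : ClassSubgroup C G => N.toSubgroup)

/-- The congruence completion: the inverse limit of the quotients of `G` by its level
stabilizers. -/
abbrev congruenceCompletion {X : Type} (G : Subgroup (treeAut X)) :=
  quotientLimit (levelStabilizer G)

/-- If all the quotients of `G` by level stabilizers lie in `C`, the canonical homomorphism from
the pro-`C` completion to the congruence completion keeps from a compatible family its coordinates
at the level stabilizers. -/
def proToCongruence {X : Type} {C : GroupClass} {G : Subgroup (treeAut X)}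
    (hC : ∀ n, C (G ⧸ levelStabilizer G n)) :
    proCompletion C G →* congruenceCompletion G where
  toFun x := ⟨fun n => x.1 ⟨levelStabilizer G n, inferInstance, hC n⟩,
    fun i j h => x.2 ⟨levelStabilizer G i, inferInstance, hC i⟩
      ⟨levelStabilizer G j, inferInstance, hC j⟩ h⟩
  map_one' := rfl
  map_mul' _ _ := rfl

/-! ### The GGS-group with constant defining vector

The letters `1, 2, …, p` are taken modulo `p`, so that the last letter `p` is `0 : ZMod p`. -/

/-- The map `x w ↦ (x + k) w` on words. -/
def rotateFun (p : ℕ) (k : ZMod p) : List (ZMod p) → List (ZMod p)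
  | [] => []
  | x :: w => (x + k) :: w

/-- The map with sections `(a ^ k, …, a ^ k, itself)`, `a` being the rotation `x w ↦ (x + 1) w`:
it fixes all letters of the first level, acts as `x w ↦ (x + k) w` on the first `p - 1` subtrees,
and as itself on the last subtree. -/
def directedFun (p : ℕ) (k : ZMod p) : List (ZMod p) → List (ZMod p)
  | [] => []
  | x :: w => x :: if x = 0 then directedFun p k w else rotateFun p k w

lemma rotateFun_rotateFun (p : ℕ) (k l : ZMod p) (h : k + l = 0) (v : List (ZMod p)) :
    rotateFun p l (rotateFun p k v) = v := by
  cases v <;> simp [rotateFun, add_assoc, h]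

lemma directedFun_directedFun (p : ℕ) (k l : ZMod p) (h : k + l = 0) (v : List (ZMod p)) :
    directedFun p l (directedFun p k v) = v := by
  induction v with
  | nil => rfl
  | cons x w ih =>
    by_cases hx : x = 0
    · simp [directedFun, hx, ih]
    · simp [directedFun, hx, rotateFun_rotateFun p k l h]

lemma rotateFun_length (p : ℕ) (k : ZMod p) (v : List (ZMod p)) :
    (rotateFun p k v).length = v.length := by
  cases v <;> simp [rotateFun]

lemma directedFun_length (p : ℕ) (k : ZMod p) (v : List (ZMod p)) :
    (directedFun p k v).length = v.length := by
  induction v with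
  | nil => rfl
  | cons x w ih =>
    by_cases hx : x = 0
    · simp [directedFun, hx, ih]
    · simp [directedFun, hx, rotateFun_length]

lemma rotateFun_prefix (p : ℕ) (k : ZMod p) (u v : List (ZMod p)) :
    rotateFun p k u <+: rotateFun p k v ↔ u <+: v := by
  cases u <;> cases v <;> simp [rotateFun, List.cons_prefix_cons]

lemma directedFun_prefix (p : ℕ) (k : ZMod p) (u v : List (ZMod p)) :
    directedFun p k u <+: directedFun p k v ↔ u <+: v := by
  induction u generalizing v with
  | nil => simp [directedFun]
  | cons x u ih =>
    cases v with
    | nil => simp [directedFun]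
    | cons y v =>
      simp only [directedFun, List.cons_prefix_cons]
      refine and_congr_right ?_
      rintro rfl
      by_cases hx : x = 0
      · simp [hx, ih]
      · simp [hx, rotateFun_prefix]

/-- The rooted automorphism `a`, which permutes the vertices of the first level (and the subtrees
rooted there) according to the cycle `(1 2 … p)`. -/
def ggsA (p : ℕ) : treeAut (ZMod p) :=
  ⟨⟨rotateFun p 1, rotateFun p (-1), rotateFun_rotateFun p 1 (-1) (by ring),
    rotateFun_rotateFun p (-1) 1 (by ring)⟩, rotateFun_length p 1, rotateFun_prefix p 1⟩

/-- The directed automorphism `b = (a, …, a, b)`. -/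
def ggsB (p : ℕ) : treeAut (ZMod p) :=
  ⟨⟨directedFun p 1, directedFun p (-1), directedFun_directedFun p 1 (-1) (by ring),
    directedFun_directedFun p (-1) 1 (by ring)⟩, directedFun_length p 1, directedFun_prefix p 1⟩

/-- The GGS-group with constant defining vector, generated by `a` and `b`. -/
def ggsGroup (p : ℕ) : Subgroup (treeAut (ZMod p)) :=
  Subgroup.closure {ggsA p, ggsB p}

/-! ### Level fixers, rooted and directed automorphisms -/

lemma treeAut_ext {X : Type} {g h : treeAut X} (H : ∀ v, g.1 v = h.1 v) : g = h :=
  Subtype.ext (Equiv.ext H)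

lemma treeAut_nil {X : Type} (g : treeAut X) : g.1 [] = [] :=
  List.length_eq_zero_iff.1 (g.2.1 [])

lemma treeAut_mul_apply {X : Type} (g h : treeAut X) (v : List X) : (g * h).1 v = g.1 (h.1 v) := rfl

lemma treeAut_one_apply {X : Type} (v : List X) : (1 : treeAut X).1 v = v := rfl

/-- The tree automorphisms that fix all vertices of level `n`. -/
def levelFixer (X : Type) (n : ℕ) : Subgroup (treeAut X) where
  carrier := {g | ∀ v : List X, v.length = n → g.1 v = v}
  one_mem' := by simp
  mul_mem' := by
    intro g h hg hh v hv
    rw [treeAut_mul_apply, hh v hv, hg v hv]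
  inv_mem' := by
    intro g hg v hv
    have h1 := hg v hv
    simp [Equiv.symm_apply_eq, h1]

lemma mem_levelStabilizer {X : Type} {G : Subgroup (treeAut X)} {n : ℕ} {g : G} :
    g ∈ levelStabilizer G n ↔ (g : treeAut X) ∈ levelFixer X n := Iff.rfl

lemma levelFixer_antitone (X : Type) [Inhabited X] : Antitone (levelFixer X) := by
  intro m n hmn g hg v hv
  have h1 := hg (v ++ List.replicate (n - m) default) (by simp [hv, hmn])
  have h2 := (g.2.2 v (v ++ List.replicate (n - m) default)).2 (List.prefix_append _ _)
  rw [h1] at h2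
  exact (List.prefix_of_prefix_length_le h2 (List.prefix_append v _)
    (g.2.1 v).le).eq_of_length (g.2.1 v)

lemma levelFixer_zero (X : Type) (g : treeAut X) : g ∈ levelFixer X 0 := by
  intro v hv
  rw [List.length_eq_zero_iff.1 hv, treeAut_nil]

section Tree

variable {p : ℕ}

/-- The automorphism with sections `f x`, fixing the first level. -/
def tuple : (ZMod p → treeAut (ZMod p)) →* treeAut (ZMod p) where
  toFun f :=
    ⟨{ toFun := fun v => match v with
        | [] => []
        | x :: w => x :: (f x).1 w
       invFun := fun v => match v with
        | [] => []
        | x :: w => x :: (f x)⁻¹.1 w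
       left_inv := by rintro (_ | ⟨x, w⟩) <;> simp
       right_inv := by rintro (_ | ⟨x, w⟩) <;> simp },
      by
        rintro (_ | ⟨x, w⟩)
        · rfl
        · simpa using (f x).2.1 w,
      by
        rintro (_ | ⟨x, u⟩) (_ | ⟨y, v⟩) <;> simp [List.cons_prefix_cons]
        rintro rfl
        exact (f x).2.2 u v⟩
  map_one' := treeAut_ext (by rintro (_ | ⟨x, w⟩) <;> rfl)
  map_mul' f g := treeAut_ext (by rintro (_ | ⟨x, w⟩) <;> rfl)

lemma tuple_cons (f : ZMod p → treeAut (ZMod p)) (x : ZMod p) (w : List (ZMod p)) :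
    (tuple f).1 (x :: w) = x :: (f x).1 w := rfl

lemma tuple_injective : Function.Injective (tuple (p := p)) := by
  intro f g h
  funext x
  refine treeAut_ext fun w => ?_
  have := congrArg (fun k : treeAut (ZMod p) => k.1 (x :: w)) h
  simpa [tuple_cons] using this

lemma tuple_mem_levelFixer {f : ZMod p → treeAut (ZMod p)} {n : ℕ} :
    tuple f ∈ levelFixer (ZMod p) (n + 1) ↔ ∀ x, f x ∈ levelFixer (ZMod p) n := by
  constructor
  · intro h x v hv
    have := h (x :: v) (by simp [hv])
    simpa [tuple_cons] using this
  · rintro h (_ | ⟨x, v⟩) hv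
    · rfl
    · rw [tuple_cons, h x v (by simpa using hv)]

/-- The rooted automorphism `x w ↦ (x + k) w`. -/
def rot (k : ZMod p) : treeAut (ZMod p) :=
  ⟨⟨rotateFun p k, rotateFun p (-k), rotateFun_rotateFun p k (-k) (by ring),
    rotateFun_rotateFun p (-k) k (by ring)⟩, rotateFun_length p k, rotateFun_prefix p k⟩

lemma rot_cons (k x : ZMod p) (w : List (ZMod p)) : (rot k).1 (x :: w) = (x + k) :: w := rfl

lemma rot_one : rot 1 = ggsA p := rfl

lemma rot_zero : rot (0 : ZMod p) = 1 :=
  treeAut_ext (by rintro (_ | ⟨x, w⟩) <;> simp [rot, rotateFun])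

lemma rot_add (k l : ZMod p) : rot (k + l) = rot k * rot l :=
  treeAut_ext (by
    rintro (_ | ⟨x, w⟩)
    · rfl
    · rw [treeAut_mul_apply, rot_cons, rot_cons, rot_cons, add_assoc, add_comm k])

lemma rot_neg (k : ZMod p) : rot (-k) = (rot k)⁻¹ :=
  eq_inv_of_mul_eq_one_left (by rw [← rot_add, neg_add_cancel, rot_zero])

lemma rot_natCast (n : ℕ) : rot (n : ZMod p) = ggsA p ^ n := by
  induction n with
  | zero => simp [rot_zero]
  | succ n ih => rw [Nat.cast_succ, rot_add, ih, rot_one, pow_succ]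

lemma rot_injective : Function.Injective (rot (p := p)) := by
  intro k l h
  have := congrArg (fun g : treeAut (ZMod p) => g.1 [0]) h
  simpa [rot_cons] using this

lemma rot_mul_tuple (k : ZMod p) (f : ZMod p → treeAut (ZMod p)) :
    rot k * tuple f = tuple (fun x => f (x - k)) * rot k :=
  treeAut_ext (by
    rintro (_ | ⟨x, w⟩)
    · rfl
    · simp [rot_cons, tuple_cons])

lemma rot_conj_tuple (k : ZMod p) (f : ZMod p → treeAut (ZMod p)) :
    rot k * tuple f * rot (-k) = tuple (fun x => f (x - k)) := by
  rw [rot_mul_tuple, rot_neg, mul_inv_cancel_right]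

lemma ggsB_eq : ggsB p = tuple (fun x => if x = 0 then ggsB p else ggsA p) :=
  treeAut_ext (by
    rintro (_ | ⟨x, w⟩)
    · rfl
    · rw [tuple_cons]
      change directedFun p 1 (x :: w) = _
      rw [directedFun]
      split_ifs <;> rfl)

lemma conj_ggsB (i : ZMod p) :
    rot i * ggsB p * rot (-i) = tuple (fun x => if x = i then ggsB p else ggsA p) := by
  rw [ggsB_eq, rot_conj_tuple]
  simp only [sub_eq_zero, ← ggsB_eq]

lemma ggsA_pow : ggsA p ^ p = 1 := by
  rw [← rot_natCast, CharP.cast_eq_zero, rot_zero]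

lemma ggsB_pow : ggsB p ^ p = 1 := by
  refine treeAut_ext fun v => ?_
  induction v with
  | nil => exact treeAut_nil _
  | cons x w ih =>
    rw [ggsB_eq, ← map_pow, tuple_cons]
    by_cases hx : x = 0
    · simp only [Pi.pow_apply, hx, if_true, ih]; rfl
    · simp only [Pi.pow_apply, hx, if_false, ggsA_pow]; rfl

end Tree

/-! ### The affine group and the graph of the action of the GGS-group on it -/

/-- The affine maps `z ↦ χ lin * z + tr`, with linear part recorded by `lin`. -/
@[ext] structure Aff {p : ℕ} {O : Type} [CommRing O] (χ : AddChar (ZMod p) O) where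
  lin : ZMod p
  tr : O

@[to_additive]
lemma prod_range_eq_prod_zmod {p : ℕ} [NeZero p] {M : Type*} [CommMonoid M] (f : ZMod p → M) :
    ∏ i ∈ Finset.range p, f i = ∏ x : ZMod p, f x :=
  Finset.prod_bij' (fun i _ => (i : ZMod p)) (fun x _ => x.val) (by simp)
    (fun x _ => Finset.mem_range.2 x.val_lt)
    (fun i hi => ZMod.val_cast_of_lt (Finset.mem_range.1 hi)) (by simp) (by simp)

section Affine

variable {p : ℕ} {O : Type} [CommRing O] {χ : AddChar (ZMod p) O}

instance : Group (Aff χ) where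
  mul u v := ⟨u.lin + v.lin, u.tr + χ u.lin * v.tr⟩
  one := ⟨0, 0⟩
  inv u := ⟨-u.lin, -(χ (-u.lin) * u.tr)⟩
  mul_assoc u v w := Aff.ext (add_assoc _ _ _) (by
    change u.tr + χ u.lin * v.tr + χ (u.lin + v.lin) * w.tr
      = u.tr + χ u.lin * (v.tr + χ v.lin * w.tr)
    rw [AddChar.map_add_eq_mul]; ring)
  one_mul u := Aff.ext (zero_add _) (by
    change 0 + χ 0 * u.tr = u.tr
    simp)
  mul_one u := Aff.ext (add_zero _) (by
    change u.tr + χ u.lin * 0 = u.tr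
    simp)
  inv_mul_cancel u := Aff.ext (neg_add_cancel _) (by
    change -(χ (-u.lin) * u.tr) + χ (-u.lin) * u.tr = 0
    simp)

lemma Aff.lin_mul (u v : Aff χ) : (u * v).lin = u.lin + v.lin := rfl
lemma Aff.tr_mul (u v : Aff χ) : (u * v).tr = u.tr + χ u.lin * v.tr := rfl
lemma Aff.lin_one : (1 : Aff χ).lin = 0 := rfl
lemma Aff.tr_one : (1 : Aff χ).tr = 0 := rfl
lemma Aff.lin_inv (u : Aff χ) : u⁻¹.lin = -u.lin := rfl

lemma Aff.lin_pow (u : Aff χ) (n : ℕ) : (u ^ n).lin = n * u.lin := by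
  induction n with
  | zero => simp [Aff.lin_one]
  | succ n ih => rw [pow_succ, Aff.lin_mul, ih]; push_cast; ring

variable (χ) in
/-- The translation by `t`. -/
def transl (t : O) : Aff χ := ⟨0, t⟩

lemma transl_zero : transl χ 0 = 1 := rfl

lemma transl_add (s t : O) : transl χ (s + t) = transl χ s * transl χ t :=
  Aff.ext (by simp [transl, Aff.lin_mul]) (by simp [transl, Aff.tr_mul])

lemma transl_neg (t : O) : transl χ (-t) = (transl χ t)⁻¹ :=
  eq_inv_of_mul_eq_one_left (by rw [← transl_add, neg_add_cancel, transl_zero])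

lemma transl_pow (t : O) (n : ℕ) : transl χ t ^ n = transl χ (n * t) := by
  induction n with
  | zero => simp [transl_zero]
  | succ n ih => rw [pow_succ, ih, ← transl_add]; push_cast; ring_nf

lemma eq_transl {u : Aff χ} (h : u.lin = 0) : u = transl χ u.tr := Aff.ext h rfl

variable (χ)

/-- The pair of `rot k` and its action `z ↦ χ k * z`. -/
def rotPair (k : ZMod p) : treeAut (ZMod p) × Aff χ := (rot k, ⟨k, 0⟩)

/-- The pair of the directed automorphism and its action `z ↦ χ 1 * z + 1`. -/
def dirPair : treeAut (ZMod p) × Aff χ := (ggsB p, ⟨1, 1⟩)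

/-- The graph of the homomorphism from the GGS-group to the affine group with `a ↦ (z ↦ χ 1 * z)`,
`b ↦ (z ↦ χ 1 * z + 1)`. -/
def graph : Subgroup (treeAut (ZMod p) × Aff χ) := Subgroup.closure {rotPair χ 1, dirPair χ}

/-- The conjugate of `dirPair` whose tree automorphism has section `ggsB` at `i`. -/
def dirConj (i : ZMod p) : treeAut (ZMod p) × Aff χ := rotPair χ i * dirPair χ * rotPair χ (-i)

/-- The section at `x` of `dirConj i`, as a pair. -/
def dirSection (x i : ZMod p) : treeAut (ZMod p) × Aff χ :=
  if x = i then dirPair χ else rotPair χ 1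

variable {χ}

lemma rotPair_zero : rotPair χ 0 = 1 := Prod.ext rot_zero rfl

lemma rotPair_add (k l : ZMod p) : rotPair χ (k + l) = rotPair χ k * rotPair χ l :=
  Prod.ext (rot_add k l) (Aff.ext rfl (by simp [rotPair, Aff.tr_mul]))

lemma rotPair_neg (k : ZMod p) : rotPair χ (-k) = (rotPair χ k)⁻¹ :=
  eq_inv_of_mul_eq_one_left (by rw [← rotPair_add, neg_add_cancel, rotPair_zero])

lemma rotPair_natCast (n : ℕ) : rotPair χ (n : ZMod p) = rotPair χ 1 ^ n := by
  induction n with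
  | zero => simp [rotPair_zero]
  | succ n ih => rw [Nat.cast_succ, rotPair_add, ih, pow_succ]

lemma rotPair_mem (k : ZMod p) [NeZero p] : rotPair χ k ∈ graph χ := by
  rw [← ZMod.natCast_zmod_val k, rotPair_natCast]
  exact pow_mem (Subgroup.subset_closure (by simp)) _

lemma dirPair_mem : dirPair χ ∈ graph χ := Subgroup.subset_closure (by simp)

lemma dirConj_mem (i : ZMod p) [NeZero p] : dirConj χ i ∈ graph χ :=
  mul_mem (mul_mem (rotPair_mem i) dirPair_mem) (rotPair_mem _)

lemma dirSection_mem (x i : ZMod p) [NeZero p] : dirSection χ x i ∈ graph χ := by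
  unfold dirSection
  split_ifs
  exacts [dirPair_mem, rotPair_mem 1]

lemma dirConj_fst (i : ZMod p) : (dirConj χ i).1 = tuple fun x => (dirSection χ x i).1 := by
  refine (conj_ggsB i).trans (congrArg tuple (funext fun x => ?_))
  unfold dirSection
  split_ifs <;> rfl

lemma dirConj_snd (i : ZMod p) : (dirConj χ i).2 = ⟨1, χ i⟩ := by
  refine Aff.ext ?_ ?_ <;> simp [dirConj, rotPair, dirPair, Aff.lin_mul, Aff.tr_mul]

lemma dirSection_lin (x i : ZMod p) : (dirSection χ x i).2.lin = 1 := by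
  unfold dirSection
  split_ifs <;> rfl

lemma dirSection_tr (x i : ZMod p) : (dirSection χ x i).2.tr = if x = i then 1 else 0 := by
  unfold dirSection
  split_ifs <;> rfl

lemma dirPair_snd_pow (n : ℕ) : ((dirPair χ).2 ^ n).tr = ∑ i ∈ Finset.range n, χ i := by
  induction n with
  | zero => simp [Aff.tr_one]
  | succ n ih => rw [pow_succ, Aff.tr_mul, ih, Finset.sum_range_succ, Aff.lin_pow]; simp [dirPair]

variable [Fact p.Prime]

lemma dirPair_pow (hχ : ∑ x, χ x = 0) : dirPair χ ^ p = 1 := by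
  refine Prod.ext ggsB_pow (Aff.ext ?_ ?_)
  · rw [Prod.pow_snd, Aff.lin_pow]; simp [Aff.lin_one]
  · rw [Prod.pow_snd, dirPair_snd_pow, sum_range_eq_sum_zmod (fun x => χ x), hχ]; rfl

/-- Every element of the graph is a product of conjugates of `dirPair` times a rotation. -/
lemma exists_list_of_mem_graph (hχ : ∑ x, χ x = 0) {g : treeAut (ZMod p) × Aff χ}
    (hg : g ∈ graph χ) :
    ∃ (l : List (ZMod p)) (k : ZMod p), g = (l.map (dirConj χ)).prod * rotPair χ k := by
  have key : ∀ (l : List (ZMod p)) (k : ZMod p),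
      (l.map (dirConj χ)).prod * rotPair χ k * dirPair χ =
        ((l ++ [k]).map (dirConj χ)).prod * rotPair χ k := by
    intro l k
    simp only [List.map_append, List.prod_append, List.map_cons, List.map_nil, List.prod_cons,
      List.prod_nil, mul_one, dirConj, mul_assoc, ← rotPair_add, neg_add_cancel, rotPair_zero]
  have key2 : ∀ (n : ℕ) (l : List (ZMod p)) (k : ZMod p), ∃ l' : List (ZMod p),
      (l.map (dirConj χ)).prod * rotPair χ k * dirPair χ ^ n =
        (l'.map (dirConj χ)).prod * rotPair χ k := by
    intro n
    induction n with
    | zero => exact fun l k => ⟨l, by simp⟩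
    | succ n ih =>
      intro l k
      obtain ⟨l', hl'⟩ := ih (l ++ [k]) k
      exact ⟨l', by rw [pow_succ', ← mul_assoc, key, hl']⟩
  induction hg using Subgroup.closure_induction_right with
  | one => exact ⟨[], 0, by simp [rotPair_zero]⟩
  | mul_right x _ y hy ih =>
    obtain ⟨l, k, rfl⟩ := ih
    rcases hy with rfl | rfl
    · exact ⟨l, k + 1, by rw [mul_assoc, ← rotPair_add]⟩
    · exact ⟨_, _, key l k⟩
  | mul_inv_cancel x _ y hy ih =>
    obtain ⟨l, k, rfl⟩ := ih
    rcases hy with rfl | rfl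
    · exact ⟨l, k + -1, by rw [mul_assoc, ← rotPair_neg, ← rotPair_add]⟩
    · have : (dirPair χ)⁻¹ = dirPair χ ^ (p - 1) := by
        rw [inv_eq_iff_mul_eq_one, ← pow_succ',
          Nat.sub_add_cancel (Fact.out : p.Prime).one_lt.le, dirPair_pow hχ]
      obtain ⟨l', hl'⟩ := key2 (p - 1) l k
      exact ⟨l', k, by rw [this, hl']⟩

omit [Fact p.Prime] in
lemma prod_dirConj_fst (l : List (ZMod p)) :
    (l.map (dirConj χ)).prod.1 = tuple fun x => (l.map (dirSection χ x)).prod.1 := by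
  induction l with
  | nil => exact (map_one tuple).symm
  | cons i l ih =>
    rw [List.map_cons, List.prod_cons, Prod.fst_mul, ih, dirConj_fst, ← map_mul]
    simp only [List.map_cons, List.prod_cons, Prod.fst_mul]
    rfl

lemma prod_dirConj_lin (l : List (ZMod p)) : (l.map (dirConj χ)).prod.2.lin = l.length := by
  induction l with
  | nil => simp [Aff.lin_one]
  | cons i l ih =>
    rw [List.map_cons, List.prod_cons, Prod.snd_mul, Aff.lin_mul, ih, dirConj_snd]
    simp [add_comm]

lemma prod_dirSection_lin (x : ZMod p) (l : List (ZMod p)) :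
    (l.map (dirSection χ x)).prod.2.lin = l.length := by
  induction l with
  | nil => simp [Aff.lin_one]
  | cons i l ih =>
    rw [List.map_cons, List.prod_cons, Prod.snd_mul, Aff.lin_mul, ih, dirSection_lin]
    simp [add_comm]

lemma prod_dirConj_tr (l : List (ZMod p)) :
    (l.map (dirConj χ)).prod.2.tr = ∑ x, χ x * (l.map (dirSection χ x)).prod.2.tr := by
  induction l with
  | nil => simp [Aff.tr_one]
  | cons i l ih =>
    simp only [List.map_cons, List.prod_cons, Prod.snd_mul, Aff.tr_mul, ih, dirConj_snd,
      dirSection_lin, dirSection_tr, mul_add, Finset.sum_add_distrib, Finset.mul_sum]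
    simp [mul_left_comm]

lemma sum_prod_dirSection_tr (l : List (ZMod p)) :
    ∑ x, (l.map (dirSection χ x)).prod.2.tr = ((dirPair χ).2 ^ l.length).tr := by
  induction l with
  | nil => simp [Aff.tr_one]
  | cons i l ih =>
    simp only [List.map_cons, List.prod_cons, Prod.snd_mul, Aff.tr_mul, List.length_cons, pow_succ',
      ← ih, dirSection_lin, dirSection_tr, Finset.sum_add_distrib, Finset.mul_sum]
    simp [dirPair]

lemma prod_dirSection_mem (x : ZMod p) (l : List (ZMod p)) :
    (l.map (dirSection χ x)).prod ∈ graph χ :=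
  list_prod_mem (by simp +contextual [dirSection_mem])

/-- The number of factors `dirConj` needed for a section is the number of its factors `dirPair`. -/
lemma exists_list_of_prod_dirSection (x : ZMod p) (l : List (ZMod p)) :
    ∃ (l' : List (ZMod p)) (k : ZMod p), l'.length = l.count x ∧
      (l.map (dirSection χ x)).prod = (l'.map (dirConj χ)).prod * rotPair χ k := by
  induction l using List.reverseRecOn with
  | nil => exact ⟨[], 0, by simp [rotPair_zero]⟩
  | append_singleton l i ih =>
    obtain ⟨l', k, hl, h⟩ := ih
    by_cases hx : x = i
    · refine ⟨l' ++ [k], k, by simp [hl, hx], ?_⟩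
      rw [List.map_append, List.prod_append, h]
      simp [dirSection, dirConj, mul_assoc, ← rotPair_add, rotPair_zero, hx]
    · refine ⟨l', k + 1, by simp [hl, Ne.symm hx], ?_⟩
      rw [List.map_append, List.prod_append, h]
      simp [dirSection, mul_assoc, ← rotPair_add, hx]

lemma rot_of_fix {f : ZMod p → treeAut (ZMod p)} {k : ZMod p} {n : ℕ}
    (h : tuple f * rot k ∈ levelFixer (ZMod p) (n + 1)) : k = 0 := by
  have := h (0 :: List.replicate n 0) (by simp)
  rw [treeAut_mul_apply, rot_cons, tuple_cons] at this
  simpa using (List.cons.inj this).1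

lemma dirConj_pow_eq_one (hχ : ∑ x, χ x = 0) (i : ZMod p) {n : ℕ} (hn : p ∣ n) :
    dirConj χ i ^ n = 1 := by
  obtain ⟨m, rfl⟩ := hn
  rw [dirConj, rotPair_neg, conj_pow, pow_mul, dirPair_pow hχ]
  simp

/-- The graph is the graph of a function. -/
theorem eq_one_of_mem_graph (hχ : ∑ x, χ x = 0) {w : Aff χ} (h : (1, w) ∈ graph χ) : w = 1 := by
  have key : ∀ (n : ℕ) (l : List (ZMod p)) (k : ZMod p), l.length = n →
      ((l.map (dirConj χ)).prod * rotPair χ k).1 = 1 →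
      (l.map (dirConj χ)).prod * rotPair χ k = 1 := by
    intro n
    induction n using Nat.strong_induction_on with
    | _ n ih =>
      intro l k hl h
      have hk : k = 0 := rot_of_fix (n := 0) (by
        rw [Prod.fst_mul, prod_dirConj_fst] at h
        exact h ▸ one_mem (levelFixer (ZMod p) 1))
      subst hk
      rw [rotPair_zero, mul_one] at h ⊢
      have h' := h
      rw [prod_dirConj_fst, ← map_one tuple] at h
      have hs := congrFun (tuple_injective h)
      by_cases hc : ∃ x, l.count x = l.length
      · obtain ⟨x, hx⟩ := hc
        have hlx : l = List.replicate n x := by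
          rw [List.eq_replicate_iff]
          exact ⟨hl, fun b hb => (List.count_eq_length.1 hx b hb).symm⟩
        have h1 := hs (x + 1)
        rw [hlx] at h1 ⊢
        simp only [List.map_replicate, List.prod_replicate, dirSection] at h1 ⊢
        refine dirConj_pow_eq_one hχ x ?_
        rw [if_neg (by simp), Prod.pow_fst] at h1
        change rot 1 ^ n = 1 at h1
        rw [rot_one, ← rot_natCast, ← rot_zero] at h1
        exact (ZMod.natCast_eq_zero_iff n p).1 (rot_injective h1)
      · push Not at hc
        have hall : ∀ x, (l.map (dirSection χ x)).prod = 1 := by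
          intro x
          obtain ⟨l', k, hl', he⟩ := exists_list_of_prod_dirSection (χ := χ) x l
          rw [he]
          refine ih l'.length ?_ l' k rfl (he ▸ hs x)
          rw [hl', ← hl]
          exact lt_of_le_of_ne List.count_le_length (hc x)
        refine Prod.ext h' (Aff.ext ?_ ?_)
        · rw [prod_dirConj_lin, ← prod_dirSection_lin (χ := χ) 0, hall]
        · rw [prod_dirConj_tr]
          simp [hall, Aff.tr_one]
  obtain ⟨l, k, hlk⟩ := exists_list_of_mem_graph hχ h
  have := key _ l k rfl (by rw [← hlk])
  rw [← hlk] at this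
  exact congrArg Prod.snd this

lemma graph_unique (hχ : ∑ x, χ x = 0) {g : treeAut (ZMod p)} {w w' : Aff χ}
    (h : (g, w) ∈ graph χ) (h' : (g, w') ∈ graph χ) : w = w' := by
  have := mul_mem h (inv_mem h')
  rw [Prod.inv_mk, Prod.mk_mul_mk, mul_inv_cancel] at this
  exact mul_inv_eq_one.1 (eq_one_of_mem_graph hχ this)

omit [Fact p.Prime] in
lemma map_fst_graph : (graph χ).map (MonoidHom.fst _ _) = ggsGroup p := by
  rw [graph, MonoidHom.map_closure, Set.image_pair]
  rfl

omit [Fact p.Prime] in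
lemma mem_ggsGroup {g : treeAut (ZMod p)} : g ∈ ggsGroup p ↔ ∃ w : Aff χ, (g, w) ∈ graph χ := by
  rw [← map_fst_graph (χ := χ)]
  simp [Subgroup.mem_map]

/-- Sections at the first level: their affine maps determine that of the element. -/
theorem exists_sections (hχ : ∑ x, χ x = 0) {f : ZMod p → treeAut (ZMod p)} {w : Aff χ}
    (h : (tuple f, w) ∈ graph χ) :
    ∃ u : ZMod p → Aff χ, (∀ x, (f x, u x) ∈ graph χ) ∧ (∀ x, (u x).lin = w.lin) ∧
      w.tr = ∑ x, χ x * (u x).tr ∧ (w.lin = 0 → ∑ x, (u x).tr = 0) ∧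
      ((∀ x, f x ∈ levelFixer (ZMod p) 1) → w.lin = 0) := by
  obtain ⟨l, k, hlk⟩ := exists_list_of_mem_graph hχ h
  have hk : k = 0 := by
    have h1 := congrArg Prod.fst hlk
    rw [Prod.fst_mul, prod_dirConj_fst] at h1
    refine rot_of_fix (n := 0) (f := fun x => (l.map (dirSection χ x)).prod.1) ?_
    change _ * (rotPair χ k).1 ∈ _
    rw [← h1, tuple_mem_levelFixer]
    exact fun x => levelFixer_zero _ _
  subst hk
  rw [rotPair_zero, mul_one] at hlk
  have h1 := congrArg Prod.fst hlk
  rw [prod_dirConj_fst] at h1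
  have hs := congrFun (tuple_injective h1)
  have hw : w = (l.map (dirConj χ)).prod.2 := congrArg Prod.snd hlk
  refine ⟨fun x => (l.map (dirSection χ x)).prod.2, fun x => ?_, fun x => ?_, ?_, ?_, ?_⟩
  · rw [hs x]
    exact prod_dirSection_mem x l
  · rw [prod_dirSection_lin, hw, prod_dirConj_lin]
  · rw [hw, prod_dirConj_tr]
  · intro hl
    rw [hw, prod_dirConj_lin] at hl
    obtain ⟨m, hm⟩ := (ZMod.natCast_eq_zero_iff _ p).1 hl
    rw [sum_prod_dirSection_tr, hm, pow_mul, ← Prod.pow_snd, dirPair_pow hχ]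
    simp [Aff.tr_one]
  · intro hf
    have hcount : ∀ x, (l.count x : ZMod p) = l.length := by
      intro x
      obtain ⟨l', k, hl', he⟩ := exists_list_of_prod_dirSection (χ := χ) x l
      have hk : k = 0 := by
        have h2 := hf x
        rw [hs x] at h2
        change (l.map (dirSection χ x)).prod.1 ∈ _ at h2
        rw [he, Prod.fst_mul, prod_dirConj_fst] at h2
        exact rot_of_fix h2
      rw [← hl', ← prod_dirConj_lin (χ := χ), ← prod_dirSection_lin (χ := χ) x, he, hk, rotPair_zero,
        mul_one]
    have hsum : ∀ l : List (ZMod p), ∑ x, (l.count x : ZMod p) = l.length := by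
      intro l
      induction l with
      | nil => simp
      | cons i l ih => simp [List.count_cons, Finset.sum_add_distrib, ih]
    rw [hw, prod_dirConj_lin, ← hsum]
    simp_rw [hcount]
    simp

end Affine

/-! ### The kernel of the affine action and its branching -/

/-- The values of `χ` generate the ring additively, with the same relations as the powers of a
primitive `p`-th root of unity over `ℤ`. -/
structure IsCyclotomicChar {p : ℕ} [Fact p.Prime] {O : Type} [CommRing O]
    (χ : AddChar (ZMod p) O) : Prop where
  sum_eq_zero : ∑ x, χ x = 0
  closure_range : AddSubgroup.closure (Set.range χ) = ⊤
  eq_of_sum_eq_zero : ∀ n : ZMod p → ℤ, ∑ x, n x * χ x = 0 → ∀ x, n x = n 0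
  eq_zero_of_natCast_mul : ∀ s : O, p * s = 0 → s = 0
  nontrivial : Nontrivial O

section Branching

open scoped commutatorElement

variable {p : ℕ} [Fact p.Prime] {O : Type} [CommRing O] {χ : AddChar (ZMod p) O}

variable (χ) in
/-- The elements of the GGS-group that act trivially on the affine line. -/
def affKernel : Subgroup (treeAut (ZMod p)) := (graph χ).comap (MonoidHom.inl _ _)

lemma mem_affKernel {g : treeAut (ZMod p)} : g ∈ affKernel χ ↔ (g, 1) ∈ graph χ := Iff.rfl

lemma affKernel_le : affKernel χ ≤ ggsGroup p := fun _ hg => mem_ggsGroup.2 ⟨1, hg⟩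

variable (χ) in
/-- The conjugates of `b a⁻¹` by powers of `a`. -/
def transPair (i : ZMod p) : treeAut (ZMod p) × Aff χ :=
  rotPair χ i * dirPair χ * rotPair χ (-1 - i)

lemma transPair_snd (i : ZMod p) : (transPair χ i).2 = transl χ (χ i) := by
  refine Aff.ext ?_ ?_
  · simp only [transPair, rotPair, dirPair, Prod.snd_mul, Aff.lin_mul, transl]
    ring
  · simp [transPair, rotPair, dirPair, Aff.lin_mul, Aff.tr_mul, transl]

lemma transPair_mem (i : ZMod p) : transPair χ i ∈ graph χ :=
  mul_mem (mul_mem (rotPair_mem i) dirPair_mem) (rotPair_mem _)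

lemma exists_mem_graph_transl (hχ : IsCyclotomicChar χ) (t : O) :
    ∃ g, (g, transl χ t) ∈ graph χ := by
  have ht : t ∈ AddSubgroup.closure (Set.range χ) := hχ.closure_range ▸ AddSubgroup.mem_top t
  induction ht using AddSubgroup.closure_induction with
  | mem x hx =>
    obtain ⟨i, rfl⟩ := hx
    exact ⟨(transPair χ i).1, transPair_snd (χ := χ) i ▸ transPair_mem i⟩
  | zero => exact ⟨1, one_mem _⟩
  | add s t _ _ hs ht =>
    obtain ⟨g, hg⟩ := hs
    obtain ⟨h, hh⟩ := ht
    exact ⟨g * h, by simpa [transl_add] using mul_mem hg hh⟩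
  | neg s _ hs =>
    obtain ⟨g, hg⟩ := hs
    exact ⟨g⁻¹, by simpa [transl_neg] using inv_mem hg⟩

lemma mem_closure_transPair {g : treeAut (ZMod p) × Aff χ}
    (hg : g ∈ graph χ) (hl : g.2.lin = 0) : g ∈ Subgroup.closure (Set.range (transPair χ)) := by
  have key : ∀ g ∈ graph χ, g * rotPair χ (-g.2.lin) ∈
      Subgroup.closure (Set.range (transPair χ)) := by
    intro g hg
    induction hg using Subgroup.closure_induction_right with
    | one => simp [Aff.lin_one, rotPair_zero, one_mem]
    | mul_right x _ y hy ih =>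
      rcases hy with rfl | rfl
      · convert ih using 1
        rw [mul_assoc, ← rotPair_add, Prod.snd_mul, Aff.lin_mul]
        simp [rotPair]
      · convert mul_mem ih (Subgroup.subset_closure ⟨x.2.lin, rfl⟩) using 1
        simp only [transPair, mul_assoc, Prod.snd_mul, Aff.lin_mul]
        rw [← mul_assoc (rotPair χ (-x.2.lin)), ← rotPair_add, neg_add_cancel, rotPair_zero,
          one_mul]
        simp [dirPair, sub_eq_add_neg, add_comm]
    | mul_inv_cancel x _ y hy ih =>
      rcases hy with rfl | rfl
      · convert ih using 1
        rw [mul_assoc, ← rotPair_neg, ← rotPair_add, Prod.snd_mul, Aff.lin_mul]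
        simp [rotPair]
      · convert mul_mem ih (inv_mem (Subgroup.subset_closure ⟨x.2.lin - 1, rfl⟩)) using 1
        simp only [transPair, mul_inv_rev, ← rotPair_neg, mul_assoc, Prod.snd_mul, Aff.lin_mul]
        rw [← mul_assoc (rotPair χ (-x.2.lin)), ← rotPair_add]
        simp [dirPair, rotPair_zero, Aff.lin_inv, add_comm, ← sub_eq_add_neg]
  have := key g hg
  rwa [hl, neg_zero, rotPair_zero, mul_one] at this

/-- The kernel of the affine action is contained in the commutator subgroup of the group of
elements that act as translations. -/
lemma affKernel_le_of_commutator (hχ : IsCyclotomicChar χ) {S : Subgroup (treeAut (ZMod p))}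
    (hS : ∀ g h s t, (g, transl χ s) ∈ graph χ → (h, transl χ t) ∈ graph χ → ⁅g, h⁆ ∈ S) :
    affKernel χ ≤ S := by
  set C := Subgroup.closure (Set.range (transPair χ)) with hC
  have hCg : C ≤ graph χ :=
    (Subgroup.closure_le _).2 (by rintro _ ⟨i, rfl⟩; exact transPair_mem i)
  let y : ZMod p → Abelianization C := fun i =>
    Abelianization.of ⟨transPair χ i, Subgroup.subset_closure ⟨i, rfl⟩⟩
  have hrep : ∀ x (hx : x ∈ C), ∃ n : ZMod p → ℤ,
      Abelianization.of (⟨x, hx⟩ : C) = ∏ i, y i ^ n i ∧ x.2 = transl χ (∑ i, n i * χ i) := by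
    intro x hx
    induction hx using Subgroup.closure_induction with
    | mem x hx =>
      obtain ⟨i, rfl⟩ := hx
      refine ⟨Pi.single i 1, ?_, ?_⟩
      · rw [Fintype.prod_eq_single i (by intro j hj; simp [hj])]
        simp [y]
      · rw [Fintype.sum_eq_single i (by intro j hj; simp [hj])]
        simp [transPair_snd]
    | one => exact ⟨0, (map_one Abelianization.of).trans (by simp), by simp [transl_zero]⟩
    | mul x z hx hz ihx ihz =>
      obtain ⟨n, hn, hn'⟩ := ihx
      obtain ⟨m, hm, hm'⟩ := ihz
      refine ⟨n + m, ?_, ?_⟩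
      · rw [← MulMemClass.mk_mul_mk C x z hx hz, map_mul, hn, hm]
        simp [zpow_add, Finset.prod_mul_distrib]
      · rw [Prod.snd_mul, hn', hm', ← transl_add]
        simp [add_mul, Finset.sum_add_distrib]
    | inv x hx ihx =>
      obtain ⟨n, hn, hn'⟩ := ihx
      refine ⟨-n, ?_, ?_⟩
      · have : (⟨x⁻¹, inv_mem hx⟩ : C) = ⟨x, hx⟩⁻¹ := rfl
        rw [this, map_inv, hn]
        simp
      · rw [Prod.snd_inv, hn', ← transl_neg]
        simp
  have hprod : ∏ i, y i = 1 := by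
    have hpart : ∀ n : ℕ, ∃ hn : dirPair χ ^ n * rotPair χ (-n) ∈ C,
        ∏ i ∈ Finset.range n, y i = Abelianization.of ⟨_, hn⟩ := by
      intro n
      induction n with
      | zero =>
        have h0 : dirPair χ ^ 0 * rotPair χ (-(0 : ℕ)) = 1 := by simp [rotPair_zero]
        refine ⟨h0 ▸ one_mem _, ?_⟩
        have : (⟨_, h0 ▸ one_mem _⟩ : C) = 1 := Subtype.ext h0
        rw [this]
        simp
      | succ n ih =>
        obtain ⟨hn, h⟩ := ih
        have hstep : dirPair χ ^ (n + 1) * rotPair χ (-((n + 1 : ℕ) : ZMod p)) =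
            dirPair χ ^ n * rotPair χ (-n) * transPair χ n := by
          simp only [transPair, mul_assoc]
          rw [← mul_assoc (rotPair χ (-n)), ← rotPair_add, neg_add_cancel, rotPair_zero, one_mul,
            pow_succ, mul_assoc]
          congr 3
          push_cast
          ring
        have hy : transPair χ n ∈ C := Subgroup.subset_closure ⟨_, rfl⟩
        refine ⟨hstep ▸ mul_mem hn hy, ?_⟩
        rw [Finset.prod_range_succ, h]
        change _ * Abelianization.of _ = _
        rw [← map_mul]
        exact congrArg _ (Subtype.ext hstep.symm)
    obtain ⟨hm, h⟩ := hpart p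
    rw [← prod_range_eq_prod_zmod, h]
    have : (⟨_, hm⟩ : C) = 1 := Subtype.ext (by
      simp [dirPair_pow hχ.sum_eq_zero, rotPair_zero])
    rw [this, map_one]
  intro g hg
  have hgC : (g, (1 : Aff χ)) ∈ C := mem_closure_transPair hg rfl
  obtain ⟨n, hn, hn'⟩ := hrep _ hgC
  have h0 := hχ.eq_of_sum_eq_zero n (congrArg Aff.tr hn').symm
  have hof : Abelianization.of (⟨_, hgC⟩ : C) = 1 := by
    rw [hn]
    simp_rw [h0]
    rw [Finset.prod_zpow, hprod, one_zpow]
  have hcomm : (⟨_, hgC⟩ : C) ∈ commutator C := by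
    rwa [← Abelianization.ker_of, MonoidHom.mem_ker]
  have hle : commutator C ≤ S.comap ((MonoidHom.fst _ _).comp C.subtype) := by
    rw [commutator_def, Subgroup.commutator_le]
    have htr : ∀ x : C, (x.1.1, transl χ x.1.2.tr) ∈ graph χ := by
      intro x
      obtain ⟨n, -, hx⟩ := hrep x.1 x.2
      rw [← eq_transl (by rw [hx]; rfl)]
      exact hCg x.2
    rintro x - z -
    exact hS _ _ _ _ (htr x) (htr z)
  exact hle hcomm

lemma exists_tuple_mem (i : ZMod p) {h : treeAut (ZMod p)} (hh : h ∈ ggsGroup p) :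
    ∃ f, tuple f ∈ ggsGroup p ∧ f i = h := by
  have hconj : ∀ j : ZMod p, tuple (fun x => if x = j then ggsB p else ggsA p) ∈ ggsGroup p := by
    intro j
    rw [← conj_ggsB, ← map_fst_graph (χ := (1 : AddChar (ZMod p) ℤ))]
    exact Subgroup.mem_map.2 ⟨_, dirConj_mem j, rfl⟩
  induction hh using Subgroup.closure_induction with
  | mem x hx =>
    rcases hx with rfl | rfl
    · exact ⟨_, hconj (i + 1), by simp⟩
    · exact ⟨_, hconj i, by simp⟩
  | one => exact ⟨1, by simp, rfl⟩
  | mul x y _ _ ihx ihy =>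
    obtain ⟨f, hf, rfl⟩ := ihx
    obtain ⟨g, hg, rfl⟩ := ihy
    exact ⟨f * g, by rw [map_mul]; exact mul_mem hf hg, rfl⟩
  | inv x _ ihx =>
    obtain ⟨f, hf, rfl⟩ := ihx
    exact ⟨f⁻¹, by rw [map_inv]; exact inv_mem hf, rfl⟩

lemma exists_tuple_pair_mem {i j : ZMod p} (hij : i ≠ j) {g : treeAut (ZMod p) × Aff χ}
    (hg : g ∈ Subgroup.closure (Set.range (transPair χ))) :
    ∃ f, tuple f ∈ ggsGroup p ∧ f i = g.1 ∧ ∀ x, x ≠ i → x ≠ j → f x = 1 := by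
  induction hg using Subgroup.closure_induction with
  | mem x hx =>
    obtain ⟨m, rfl⟩ := hx
    have hmem : ∀ k : ZMod p, (dirConj χ k).1 ∈ ggsGroup p := fun k =>
      mem_ggsGroup.2 ⟨_, dirConj_mem (χ := χ) k⟩
    refine ⟨(fun x => (dirSection χ x j).1) ^ m.val *
      ((fun x => (dirSection χ x i).1) * (fun x => (dirSection χ x j).1)⁻¹) *
      ((fun x => (dirSection χ x j).1) ^ m.val)⁻¹, ?_, ?_, ?_⟩
    · simp only [map_mul, map_inv, map_pow, ← dirConj_fst]
      exact mul_mem (mul_mem (pow_mem (hmem j) _) (mul_mem (hmem i) (inv_mem (hmem j))))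
        (inv_mem (pow_mem (hmem j) _))
    · have h1 : (rotPair χ 1).1 ^ m.val = rot m := by
        change rot 1 ^ _ = _
        rw [rot_one, ← rot_natCast, ZMod.natCast_zmod_val]
      simp only [Pi.mul_apply, Pi.pow_apply, Pi.inv_apply, dirSection, if_neg hij, if_true, h1]
      change rot m * (ggsB p * (rot 1)⁻¹) * (rot m)⁻¹ = rot m * ggsB p * rot (-1 - m)
      rw [← rot_neg, ← rot_neg, sub_eq_add_neg, rot_add]
      simp only [mul_assoc]
    · intro x hxi hxj
      simp only [Pi.mul_apply, Pi.pow_apply, Pi.inv_apply, dirSection, if_neg hxi, if_neg hxj]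
      group
  | one => exact ⟨1, by simp, rfl, fun _ _ _ => rfl⟩
  | mul x y _ _ ihx ihy =>
    obtain ⟨f, hf, hfi, hfx⟩ := ihx
    obtain ⟨g, hg, hgi, hgx⟩ := ihy
    exact ⟨f * g, by rw [map_mul]; exact mul_mem hf hg, by simp [hfi, hgi],
      fun x h1 h2 => by simp [hfx x h1 h2, hgx x h1 h2]⟩
  | inv x _ ihx =>
    obtain ⟨f, hf, hfi, hfx⟩ := ihx
    exact ⟨f⁻¹, by rw [map_inv]; exact inv_mem hf, by simp [hfi],
      fun x h1 h2 => by simp [hfx x h1 h2]⟩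

/-- An element acting as a translation occurs as the section at `i` of an element of the GGS-group
whose only other nontrivial section is at `j`. -/
lemma exists_tuple_pair (hχ : ∑ x, χ x = 0) {i j : ZMod p} (hij : i ≠ j)
    {k : treeAut (ZMod p)} {t : O} (hk : (k, transl χ t) ∈ graph χ) :
    ∃ f, f i = k ∧ (f j, transl χ (-t)) ∈ graph χ ∧ (∀ x, x ≠ i → x ≠ j → f x = 1) ∧
      (tuple f, transl χ ((χ i - χ j) * t)) ∈ graph χ := by
  obtain ⟨f, hf, hfi, hfx⟩ := exists_tuple_pair_mem hij (mem_closure_transPair hk rfl)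
  obtain ⟨w, hw⟩ := mem_ggsGroup (χ := χ).1 hf
  obtain ⟨u, hu, hlin, htr, hsum, -⟩ := exists_sections hχ hw
  have hui : u i = transl χ t := graph_unique hχ (hu i) (by rw [hfi]; exact hk)
  have hux : ∀ x, x ≠ i ∧ x ≠ j → u x = 1 := fun x hx =>
    graph_unique hχ (hu x) (by rw [hfx x hx.1 hx.2]; exact one_mem _)
  have hwl : w.lin = 0 := by rw [← hlin i, hui]; rfl
  have huj : (u j).tr = -t := by
    have := hsum hwl
    rw [Fintype.sum_eq_add i j hij (fun x hx => by rw [hux x hx, Aff.tr_one]), hui] at this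
    exact (neg_eq_of_add_eq_zero_right this).symm
  rw [Fintype.sum_eq_add i j hij (fun x hx => by rw [hux x hx, Aff.tr_one, mul_zero]), hui,
    huj] at htr
  refine ⟨f, hfi, ?_, hfx, ?_⟩
  · rw [← huj, ← eq_transl ((hlin j).trans hwl)]
    exact hu j
  · rw [eq_transl hwl, htr] at hw
    convert hw using 3
    simp only [transl]
    ring

lemma addChar_sub_dvd {i j l : ZMod p} (hlj : l ≠ j) :
    χ l - χ j ∣ χ i - χ j := by
  have h1 : ∀ x, χ x - χ j = χ j * (χ (x - j) - 1) := by
    intro x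
    rw [mul_sub, ← AddChar.map_add_eq_mul]
    simp
  have h2 : i - j = ((i - j) / (l - j)).val • (l - j) := by
    rw [nsmul_eq_mul, ZMod.natCast_zmod_val, div_mul_cancel₀ _ (sub_ne_zero.2 hlj)]
  rw [h1, h1]
  refine mul_dvd_mul_left _ ?_
  rw [h2, AddChar.map_nsmul_eq_pow]
  simpa using sub_dvd_pow_sub_pow (χ (l - j)) 1 ((i - j) / (l - j)).val

/-- Every element acting as a translation is a section at `i` of an element of the kernel of the
affine action whose only other nontrivial sections are at `j` and `l`. -/
lemma exists_tuple_mem_affKernel (hχ : IsCyclotomicChar χ) {i j l : ZMod p} (hij : i ≠ j)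
    (hil : i ≠ l) (hlj : l ≠ j) {k : treeAut (ZMod p)} {t : O} (hk : (k, transl χ t) ∈ graph χ) :
    ∃ f, f i = k ∧ (∀ x, x ≠ i → x ≠ j → x ≠ l → f x = 1) ∧ tuple f ∈ affKernel χ := by
  obtain ⟨u, hu⟩ := addChar_sub_dvd (χ := χ) (i := i) hlj
  obtain ⟨m, hm⟩ := exists_mem_graph_transl hχ (-(u * t))
  obtain ⟨f, hfi, -, hfx, hf⟩ := exists_tuple_pair hχ.sum_eq_zero hij hk
  obtain ⟨g, -, -, hgx, hg⟩ := exists_tuple_pair hχ.sum_eq_zero hlj hm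
  refine ⟨f * g, ?_, fun x h1 h2 h3 => ?_, ?_⟩
  · rw [Pi.mul_apply, hfi, hgx i hil hij, mul_one]
  · rw [Pi.mul_apply, hfx x h1 h2, hgx x h3 h2, mul_one]
  · have := mul_mem hf hg
    rw [Prod.mk_mul_mk, ← map_mul, ← transl_add, hu] at this
    rw [mem_affKernel, ← transl_zero]
    convert this using 3
    ring

omit [Fact p.Prime] in
/-- The subgroup of the automorphisms fixing the first level with all sections in `S`. -/
def spread (S : Subgroup (treeAut (ZMod p))) : Subgroup (treeAut (ZMod p)) :=
  (Subgroup.pi Set.univ fun _ => S).map tuple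

omit [Fact p.Prime] in
lemma mem_spread {S : Subgroup (treeAut (ZMod p))} {g : treeAut (ZMod p)} :
    g ∈ spread S ↔ ∃ f, (∀ x, f x ∈ S) ∧ tuple f = g := by
  simp [spread, Subgroup.mem_map, Subgroup.mem_pi]

omit [Fact p.Prime] in
lemma tuple_mem_spread {S : Subgroup (treeAut (ZMod p))} {f : ZMod p → treeAut (ZMod p)} :
    tuple f ∈ spread S ↔ ∀ x, f x ∈ S := by
  rw [mem_spread]
  constructor
  · rintro ⟨g, hg, h⟩
    rwa [← tuple_injective h]
  · exact fun h => ⟨f, h, rfl⟩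

omit [Fact p.Prime] in
lemma spread_mono : Monotone (spread (p := p)) := by
  intro S S' h g hg
  obtain ⟨f, hf, rfl⟩ := mem_spread.1 hg
  exact tuple_mem_spread.2 fun x => h (hf x)

lemma spread_le {S N : Subgroup (treeAut (ZMod p))}
    (h : ∀ x, ∀ s ∈ S, tuple (Pi.mulSingle x s) ∈ N) : spread S ≤ N := by
  intro g hg
  obtain ⟨f, hf, rfl⟩ := mem_spread.1 hg
  exact Subgroup.pi_mem_of_mulSingle_mem (H := N.comap tuple) f fun x => h x _ (hf x)

lemma natCast_ne_natCast {m n : ℕ} (hm : m < p) (hn : n < p) (h : m ≠ n) :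
    (m : ZMod p) ≠ n := by
  intro h'
  rw [ZMod.natCast_eq_natCast_iff'] at h'
  rw [Nat.mod_eq_of_lt hm, Nat.mod_eq_of_lt hn] at h'
  exact h h'

/-- The kernel of the affine action is weakly regular branch, over its commutator subgroup. -/
theorem tuple_mulSingle_mem_commutator (hχ : IsCyclotomicChar χ) (hp5 : 5 ≤ p) (x : ZMod p)
    {r : treeAut (ZMod p)} (hr : r ∈ affKernel χ) :
    tuple (Pi.mulSingle x r) ∈ ⁅affKernel χ, affKernel χ⁆ := by
  refine affKernel_le_of_commutator hχ
    (S := ⁅affKernel χ, affKernel χ⁆.comap (tuple.comp (MonoidHom.mulSingle (fun _ => treeAut (ZMod p)) x))) ?_ hr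
  intro g h s t hg hh
  have hd : ∀ m n : ℕ, m < 5 → n < 5 → m ≠ n → x + (m : ZMod p) ≠ x + n := by
    intro m n hm hn hmn h
    exact natCast_ne_natCast (hm.trans_le hp5) (hn.trans_le hp5) hmn (add_left_cancel h)
  have h0 : ∀ n : ℕ, n < 5 → n ≠ 0 → x ≠ x + (n : ZMod p) := by
    intro n hn hn0
    simpa using hd 0 n (by simp) hn hn0.symm
  obtain ⟨f₁, h1x, h1, hf1⟩ := exists_tuple_mem_affKernel hχ (i := x) (j := x + (1 : ℕ))
    (l := x + (2 : ℕ)) (h0 1 (by simp) (by simp))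
    (h0 2 (by simp) (by simp)) (hd 2 1 (by simp) (by simp) (by simp)) hg
  obtain ⟨f₂, h2x, h2, hf2⟩ := exists_tuple_mem_affKernel hχ (i := x) (j := x + (3 : ℕ))
    (l := x + (4 : ℕ)) (h0 3 (by simp) (by simp))
    (h0 4 (by simp) (by simp)) (hd 4 3 (by simp) (by simp) (by simp)) hh
  have hcomm : Pi.mulSingle x ⁅g, h⁆ = ⁅f₁, f₂⁆ := by
    funext y
    rw [commutatorElement_def f₁, Pi.mul_apply, Pi.mul_apply, Pi.mul_apply, Pi.inv_apply,
      Pi.inv_apply]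
    by_cases hy : y = x
    · rw [hy, Pi.mulSingle_eq_same, h1x, h2x, commutatorElement_def]
    · rw [Pi.mulSingle_eq_of_ne hy]
      by_cases hy1 : y = x + (1 : ℕ) ∨ y = x + (2 : ℕ)
      · rw [h2 y hy]
        · simp
        · rcases hy1 with rfl | rfl <;> exact hd _ _ (by simp) (by simp) (by simp)
        · rcases hy1 with rfl | rfl <;> exact hd _ _ (by simp) (by simp) (by simp)
      · push Not at hy1
        rw [h1 y hy hy1.1 hy1.2]
        simp
  rw [Subgroup.mem_comap]
  change tuple (Pi.mulSingle x ⁅g, h⁆) ∈ _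
  rw [hcomm, map_commutatorElement]
  exact Subgroup.commutator_mem_commutator hf1 hf2

lemma tuple_mulSingle_mem_affKernel (hχ : IsCyclotomicChar χ) (hp5 : 5 ≤ p) (x : ZMod p)
    {r : treeAut (ZMod p)} (hr : r ∈ affKernel χ) : tuple (Pi.mulSingle x r) ∈ affKernel χ :=
  Subgroup.commutator_le_self (affKernel χ) (tuple_mulSingle_mem_commutator hχ hp5 x hr)

end Branching

/-! ### Roots modulo the kernel, and normal subgroups -/

section Congruence

open scoped commutatorElement

variable {p : ℕ} [Fact p.Prime]

lemma exists_eq_tuple_mul_rot {g : treeAut (ZMod p)} (hg : g ∈ ggsGroup p) :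
    ∃ f k, g = tuple f * rot k ∧ ∀ x, f x ∈ ggsGroup p := by
  have ha : ggsA p ∈ ggsGroup p := Subgroup.subset_closure (by simp)
  have hb : ggsB p ∈ ggsGroup p := Subgroup.subset_closure (by simp)
  induction hg using Subgroup.closure_induction with
  | mem x hx =>
    rcases hx with rfl | rfl
    · exact ⟨1, 1, by rw [map_one, one_mul, rot_one], fun x => one_mem _⟩
    · exact ⟨_, 0, by rw [rot_zero, mul_one]; exact ggsB_eq,
        fun x => by split_ifs <;> assumption⟩
  | one => exact ⟨1, 0, by rw [map_one, rot_zero, one_mul], fun x => one_mem _⟩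
  | mul x y _ _ ihx ihy =>
    obtain ⟨f, k, rfl, hf⟩ := ihx
    obtain ⟨g, l, rfl, hg⟩ := ihy
    refine ⟨f * fun x => g (x - k), k + l, ?_, fun x => mul_mem (hf x) (hg _)⟩
    rw [map_mul, mul_assoc, ← mul_assoc (rot k), rot_mul_tuple, rot_add]
    simp only [mul_assoc]
  | inv x _ ihx =>
    obtain ⟨f, k, rfl, hf⟩ := ihx
    refine ⟨fun x => f⁻¹ (x - (-k)), -k, ?_, fun x => inv_mem (hf _)⟩
    rw [mul_inv_rev, ← rot_neg, ← map_inv, rot_mul_tuple]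

lemma exists_eq_tuple_of_fix {g : treeAut (ZMod p)} {n : ℕ} (hg : g ∈ ggsGroup p)
    (hn : g ∈ levelFixer (ZMod p) (n + 1)) :
    ∃ f, g = tuple f ∧ (∀ x, f x ∈ ggsGroup p) ∧ ∀ x, f x ∈ levelFixer (ZMod p) n := by
  obtain ⟨f, k, rfl, hf⟩ := exists_eq_tuple_mul_rot hg
  have hk := rot_of_fix hn
  subst hk
  rw [rot_zero, mul_one] at hn ⊢
  exact ⟨f, rfl, hf, tuple_mem_levelFixer.1 hn⟩

/-- The quotients by the level stabilizers are `p`-groups. -/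
theorem pow_mem_levelFixer (n : ℕ) {g : treeAut (ZMod p)} (hg : g ∈ ggsGroup p) :
    g ^ p ^ n ∈ levelFixer (ZMod p) n := by
  induction n generalizing g with
  | zero => exact levelFixer_zero _ _
  | succ n ih =>
    obtain ⟨f, k, rfl, hf⟩ := exists_eq_tuple_mul_rot hg
    have key : ∀ m : ℕ, ∃ f', (∀ x, f' x ∈ ggsGroup p) ∧
        (tuple f * rot k) ^ m = tuple f' * rot ((m : ZMod p) * k) := by
      intro m
      induction m with
      | zero => exact ⟨1, fun _ => one_mem _, by simp [rot_zero]⟩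
      | succ m ih =>
        obtain ⟨f', hf', h⟩ := ih
        refine ⟨f' * fun x => f (x - m * k), fun x => mul_mem (hf' x) (hf _), ?_⟩
        rw [pow_succ, h, map_mul, mul_assoc, ← mul_assoc (rot _), rot_mul_tuple, Nat.cast_succ,
          add_mul, one_mul, rot_add]
        simp only [mul_assoc]
    obtain ⟨f', hf', h⟩ := key p
    rw [pow_succ', pow_mul, h, CharP.cast_eq_zero, zero_mul, rot_zero, mul_one, ← map_pow,
      tuple_mem_levelFixer]
    exact fun x => ih (hf' x)

variable {O : Type} [CommRing O] {χ : AddChar (ZMod p) O}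

lemma one_sub_dvd (i : ZMod p) : 1 - χ 1 ∣ χ i - 1 := by
  rw [← neg_dvd, neg_sub]
  simpa using addChar_sub_dvd (χ := χ) (i := i) (j := 0) (l := 1) one_ne_zero

/-- The affine action is continuous for the congruence topology and the `(1 - χ 1)`-adic one. -/
theorem dvd_tr_of_fix (hχ : ∑ x, χ x = 0) (n : ℕ) {g : treeAut (ZMod p)} {w : Aff χ}
    (hg : (g, w) ∈ graph χ) (hn : g ∈ levelFixer (ZMod p) (n + 2)) :
    w.lin = 0 ∧ (1 - χ 1) ^ n ∣ w.tr := by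
  induction n generalizing g w with
  | zero =>
    obtain ⟨f, rfl, -, hf⟩ := exists_eq_tuple_of_fix (mem_ggsGroup.2 ⟨w, hg⟩) hn
    obtain ⟨u, -, -, -, -, hlin⟩ := exists_sections hχ hg
    exact ⟨hlin hf, by simp⟩
  | succ n ih =>
    obtain ⟨f, rfl, -, hf⟩ := exists_eq_tuple_of_fix (mem_ggsGroup.2 ⟨w, hg⟩) hn
    obtain ⟨u, hu, hlin, htr, hsum, -⟩ := exists_sections hχ hg
    have hl : w.lin = 0 := by
      rw [← hlin 0]
      exact (ih (hu 0) (hf 0)).1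
    refine ⟨hl, ?_⟩
    have : w.tr = ∑ x, (χ x - 1) * (u x).tr := by
      simp_rw [sub_mul, one_mul, Finset.sum_sub_distrib]
      rw [hsum hl, sub_zero, htr]
    rw [this, pow_succ']
    exact Finset.dvd_sum fun x _ => mul_dvd_mul (one_sub_dvd x) (ih (hu x) (hf x)).2

lemma natCast_dvd_pow (hp5 : 5 ≤ p) : (p : O) ∣ (1 - χ 1) ^ p := by
  have hp : p.Prime := Fact.out
  obtain ⟨r, hr⟩ := exists_add_pow_prime_eq hp (1 : O) (-χ 1)
  have hodd : Odd p := hp.odd_of_ne_two (by omega)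
  have h1 : χ 1 ^ p = 1 := by
    rw [← AddChar.map_nsmul_eq_pow, nsmul_eq_mul, CharP.cast_eq_zero, zero_mul,
      AddChar.map_zero_eq_one]
  rw [sub_eq_add_neg, hr, hodd.neg_pow, h1, one_pow, add_neg_cancel, zero_add]
  exact ⟨1 * -χ 1 * r, by ring⟩

lemma exists_pow_mul_eq (hχ : ∑ x, χ x = 0) (hp5 : 5 ≤ p) (k : ℕ) {g : treeAut (ZMod p)}
    {w : Aff χ} (hg : (g, w) ∈ graph χ) (hn : g ∈ levelFixer (ZMod p) (p * k + 2)) :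
    ∃ s, w = transl χ (p ^ k * s) := by
  obtain ⟨hl, hd⟩ := dvd_tr_of_fix hχ _ hg hn
  rw [pow_mul] at hd
  obtain ⟨s, hs⟩ := (pow_dvd_pow_of_dvd (natCast_dvd_pow (χ := χ) hp5) k).trans hd
  exact ⟨s, by rw [← hs, ← eq_transl hl]⟩

lemma exists_root (hχ : IsCyclotomicChar χ) (hp5 : 5 ≤ p) (k : ℕ) {g : treeAut (ZMod p)}
    (hg : g ∈ ggsGroup p) (hn : g ∈ levelFixer (ZMod p) (p * k + 2)) :
    ∃ h ∈ ggsGroup p, (h ^ p ^ k)⁻¹ * g ∈ affKernel χ := by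
  obtain ⟨w, hw⟩ := mem_ggsGroup (χ := χ).1 hg
  obtain ⟨s, rfl⟩ := exists_pow_mul_eq hχ.sum_eq_zero hp5 k hw hn
  obtain ⟨h, hh⟩ := exists_mem_graph_transl hχ s
  refine ⟨h, mem_ggsGroup.2 ⟨_, hh⟩, ?_⟩
  have := mul_mem (inv_mem (pow_mem hh (p ^ k))) hw
  rw [mem_affKernel]
  convert this using 1
  refine Prod.ext rfl ?_
  simp [transl_pow]

lemma exists_tuple_of_sum_eq_zero (hχ : IsCyclotomicChar χ) {s : ZMod p → O} (hs : ∑ x, s x = 0) :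
    ∃ f, (∀ x, (f x, transl χ (s x)) ∈ graph χ) ∧ tuple f ∈ ggsGroup p := by
  let A : AddSubmonoid (ZMod p → O) :=
    { carrier := {s | ∃ f, (∀ x, (f x, transl χ (s x)) ∈ graph χ) ∧ tuple f ∈ ggsGroup p}
      zero_mem' := ⟨1, fun _ => one_mem _, by simp⟩
      add_mem' := by
        rintro s t ⟨f, hf, hf'⟩ ⟨g, hg, hg'⟩
        refine ⟨f * g, fun x => ?_, by rw [map_mul]; exact mul_mem hf' hg'⟩
        rw [Pi.add_apply, transl_add]
        exact mul_mem (hf x) (hg x) }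
  have hA : ∀ i t, Pi.single i t - Pi.single 0 t ∈ A := by
    intro i t
    by_cases hi : i = 0
    · subst hi
      rw [sub_self]
      exact A.zero_mem
    obtain ⟨m, hm⟩ := exists_mem_graph_transl hχ t
    obtain ⟨f, hfi, hfj, hfx, hf⟩ := exists_tuple_pair hχ.sum_eq_zero hi hm
    refine ⟨f, fun x => ?_, mem_ggsGroup.2 ⟨_, hf⟩⟩
    by_cases hxi : x = i
    · subst hxi
      simpa [hi, hfi] using hm
    by_cases hx0 : x = 0
    · subst hx0
      simpa [Ne.symm hi] using hfj
    rw [hfx x hxi hx0]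
    simp only [Pi.sub_apply, Pi.single_eq_of_ne hxi, Pi.single_eq_of_ne hx0, sub_zero]
    exact one_mem _
  have hsum : s = ∑ i, (Pi.single i (s i) - Pi.single 0 (s i)) := by
    rw [Finset.sum_sub_distrib, Finset.univ_sum_single]
    funext x
    by_cases hx : x = 0 <;> simp [Finset.sum_apply, hx, hs]
  have : s ∈ A := by
    rw [hsum]
    exact sum_mem fun i _ => hA i _
  exact this

lemma eq_zero_of_pow_mul (hχ : IsCyclotomicChar χ) (k : ℕ) {s : O} (h : (p : O) ^ k * s = 0) :
    s = 0 := by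
  induction k with
  | zero => simpa using h
  | succ k ih =>
    rw [pow_succ', mul_assoc] at h
    exact ih (hχ.eq_zero_of_natCast_mul _ h)

lemma exists_root_of_mem_affKernel (hχ : IsCyclotomicChar χ) (hp5 : 5 ≤ p) (k : ℕ)
    {g : treeAut (ZMod p)} (hg : g ∈ affKernel χ) (hn : g ∈ levelFixer (ZMod p) (p * k + 3)) :
    ∃ h ∈ affKernel χ, (h ^ p ^ k)⁻¹ * g ∈ spread (affKernel χ) := by
  obtain ⟨f, rfl, -, hf⟩ := exists_eq_tuple_of_fix (affKernel_le hg) hn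
  obtain ⟨u, hu, -, htr, hsum, -⟩ := exists_sections hχ.sum_eq_zero hg
  choose s hs using fun x => exists_pow_mul_eq hχ.sum_eq_zero hp5 k (hu x) (hf x)
  simp only [hs, Aff.tr_one, transl] at htr hsum
  have hs0 : ∑ x, s x = 0 := eq_zero_of_pow_mul hχ k (by rw [Finset.mul_sum]; exact hsum rfl)
  have hs1 : ∑ x, χ x * s x = 0 := eq_zero_of_pow_mul hχ k (by
    rw [Finset.mul_sum, htr]
    exact Finset.sum_congr rfl fun x _ => mul_left_comm _ _ _)
  obtain ⟨f', hf', hf'G⟩ := exists_tuple_of_sum_eq_zero hχ hs0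
  refine ⟨tuple f', ?_, ?_⟩
  · obtain ⟨w, hw⟩ := mem_ggsGroup (χ := χ).1 hf'G
    obtain ⟨u', hu', hlin', htr', -⟩ := exists_sections hχ.sum_eq_zero hw
    have hu's : ∀ x, u' x = transl χ (s x) := fun x =>
      graph_unique hχ.sum_eq_zero (hu' x) (hf' x)
    have hl : w.lin = 0 := by rw [← hlin' 0, hu's]; rfl
    simp only [hu's, transl] at htr'
    rw [eq_transl hl, htr', hs1] at hw
    exact hw
  · rw [← map_pow, ← map_inv, ← map_mul, tuple_mem_spread]
    intro x
    have := mul_mem (inv_mem (pow_mem (hf' x) (p ^ k))) (hu x)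
    rw [mem_affKernel]
    convert this using 1
    refine Prod.ext rfl ?_
    simp [transl_pow, hs]

variable (χ) in
/-- The product of the copies of the kernel of the affine action at the vertices of level `m`. -/
def levelKernel (m : ℕ) : Subgroup (treeAut (ZMod p)) := spread^[m] (affKernel χ)

lemma levelKernel_succ (m : ℕ) : levelKernel χ (m + 1) = spread (levelKernel χ m) :=
  Function.iterate_succ_apply' _ _ _

lemma levelKernel_succ_le (hχ : IsCyclotomicChar χ) (hp5 : 5 ≤ p) (m : ℕ) :
    levelKernel χ (m + 1) ≤ levelKernel χ m := by
  induction m with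
  | zero => exact spread_le fun x s hs => tuple_mulSingle_mem_affKernel hχ hp5 x hs
  | succ m ih =>
    have h := spread_mono ih
    rwa [← levelKernel_succ, ← levelKernel_succ] at h

lemma levelKernel_le (hχ : IsCyclotomicChar χ) (hp5 : 5 ≤ p) (m : ℕ) :
    levelKernel χ m ≤ affKernel χ := by
  induction m with
  | zero => exact le_rfl
  | succ m ih => exact (levelKernel_succ_le hχ hp5 m).trans ih

lemma exists_root_of_mem_levelKernel (hχ : IsCyclotomicChar χ) (hp5 : 5 ≤ p) (k j : ℕ)
    {g : treeAut (ZMod p)} (hg : g ∈ levelKernel χ j)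
    (hn : g ∈ levelFixer (ZMod p) (p * k + 3 + j)) :
    ∃ h ∈ levelKernel χ j, (h ^ p ^ k)⁻¹ * g ∈ levelKernel χ (j + 1) := by
  induction j generalizing g with
  | zero => exact exists_root_of_mem_affKernel hχ hp5 k hg hn
  | succ j ih =>
    rw [levelKernel_succ] at hg
    obtain ⟨f, hf, rfl⟩ := mem_spread.1 hg
    choose h hh hh' using fun x => ih (hf x) (tuple_mem_levelFixer.1 hn x)
    refine ⟨tuple h, ?_, ?_⟩
    · rw [levelKernel_succ]
      exact tuple_mem_spread.2 hh
    · rw [levelKernel_succ, ← map_pow, ← map_inv, ← map_mul]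
      exact tuple_mem_spread.2 hh'

/-- The embedding of the automorphism group as the rigid stabilizer of the vertex `v`. -/
def atVertex : List (ZMod p) → treeAut (ZMod p) →* treeAut (ZMod p)
  | [] => MonoidHom.id _
  | x :: v => (tuple.comp (MonoidHom.mulSingle (fun _ => treeAut (ZMod p)) x)).comp (atVertex v)

omit [Fact p.Prime] in
lemma atVertex_cons (x : ZMod p) (v : List (ZMod p)) (g : treeAut (ZMod p)) :
    atVertex (x :: v) g = tuple (Pi.mulSingle x (atVertex v g)) := rfl

omit [Fact p.Prime] in
lemma tuple_conj_mulSingle (f : ZMod p → treeAut (ZMod p)) (x : ZMod p) (g : treeAut (ZMod p)) :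
    tuple f * tuple (Pi.mulSingle x g) * (tuple f)⁻¹ =
      tuple (Pi.mulSingle x (f x * g * (f x)⁻¹)) := by
  rw [← map_inv, ← map_mul, ← map_mul]
  congr 1
  funext y
  by_cases hy : y = x
  · subst hy; simp
  · simp [hy]

lemma rot_conj_mulSingle (k x : ZMod p) (g : treeAut (ZMod p)) :
    rot k * tuple (Pi.mulSingle x g) * (rot k)⁻¹ = tuple (Pi.mulSingle (x + k) g) := by
  rw [← rot_neg, rot_conj_tuple]
  congr 1
  funext y
  by_cases hy : y = x + k
  · subst hy; simp
  · rw [Pi.mulSingle_eq_of_ne hy, Pi.mulSingle_eq_of_ne (by rwa [Ne, sub_eq_iff_eq_add])]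

lemma exists_conj_atVertex (v : List (ZMod p)) (r : treeAut (ZMod p)) {g : treeAut (ZMod p)}
    (hg : g ∈ ggsGroup p) : ∃ r', g * atVertex v r * g⁻¹ = atVertex (g.1 v) r' := by
  induction v generalizing g with
  | nil => exact ⟨g * r * g⁻¹, by rw [treeAut_nil]; rfl⟩
  | cons x v ih =>
    obtain ⟨f, k, rfl, hf⟩ := exists_eq_tuple_mul_rot hg
    obtain ⟨r', hr'⟩ := ih (hf (x + k))
    refine ⟨r', ?_⟩
    rw [treeAut_mul_apply, rot_cons, tuple_cons, atVertex_cons, atVertex_cons, ← hr',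
      ← tuple_conj_mulSingle, ← rot_conj_mulSingle]
    group

omit [Fact p.Prime] in
lemma atVertex_commute {u v : List (ZMod p)} (hl : u.length = v.length) (h : u ≠ v)
    (r s : treeAut (ZMod p)) : Commute (atVertex u r) (atVertex v s) := by
  induction u generalizing v with
  | nil => exact absurd (List.length_eq_zero_iff.1 hl.symm).symm h
  | cons x u ih =>
    cases v with
    | nil => simp at hl
    | cons y v =>
      rw [atVertex_cons, atVertex_cons]
      refine Commute.map ?_ tuple
      by_cases hxy : x = y
      · subst hxy
        exact (ih (by simpa using hl) (by simpa using h)).map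
          (MonoidHom.mulSingle (fun _ => treeAut (ZMod p)) x)
      · exact Pi.mulSingle_commute hxy _ _

lemma atVertex_mem_affKernel (hχ : IsCyclotomicChar χ) (hp5 : 5 ≤ p) (v : List (ZMod p))
    {r : treeAut (ZMod p)} (hr : r ∈ affKernel χ) : atVertex v r ∈ affKernel χ := by
  induction v with
  | nil => exact hr
  | cons x v ih => exact tuple_mulSingle_mem_affKernel hχ hp5 x ih

lemma levelKernel_le_of_atVertex (hχ : IsCyclotomicChar χ) (hp5 : 5 ≤ p) (v : List (ZMod p))
    {N : Subgroup (treeAut (ZMod p))} (hN : ∀ g ∈ ggsGroup p, ∀ n ∈ N, g * n * g⁻¹ ∈ N)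
    (h : ∀ r ∈ ⁅affKernel χ, affKernel χ⁆, atVertex v r ∈ N) : levelKernel χ (v.length + 1) ≤ N := by
  induction v generalizing N with
  | nil => exact spread_le fun x s hs => h _ (tuple_mulSingle_mem_commutator hχ hp5 x hs)
  | cons x v ih =>
    have hx : levelKernel χ (v.length + 1) ≤
        N.comap (tuple.comp (MonoidHom.mulSingle (fun _ => treeAut (ZMod p)) x)) := by
      refine ih ?_ h
      intro g hg n hn
      obtain ⟨f, hf, rfl⟩ := exists_tuple_mem x hg
      rw [Subgroup.mem_comap]
      change tuple (Pi.mulSingle x _) ∈ N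
      rw [← tuple_conj_mulSingle]
      exact hN _ hf _ hn
    rw [List.length_cons, levelKernel_succ]
    refine spread_le fun y s hs => ?_
    have h1 := hN (rot (y - x)) (mem_ggsGroup.2 ⟨_, rotPair_mem (χ := χ) (y - x)⟩) _ (hx hs)
    change rot _ * tuple (Pi.mulSingle x s) * _ ∈ N at h1
    rwa [rot_conj_mulSingle, add_sub_cancel] at h1

/-- A nontrivial normal subgroup contains the kernel of the affine action at all vertices of some
level. -/
theorem exists_levelKernel_le (hχ : IsCyclotomicChar χ) (hp5 : 5 ≤ p)
    {N : Subgroup (treeAut (ZMod p))} (hN : ∀ g ∈ ggsGroup p, ∀ n ∈ N, g * n * g⁻¹ ∈ N)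
    {g : treeAut (ZMod p)} (hg : g ∈ ggsGroup p) (hgN : g ∈ N) (h1 : g ≠ 1) :
    ∃ m, levelKernel χ m ≤ N := by
  obtain ⟨v, hv⟩ : ∃ v, g.1 v ≠ v := by
    by_contra! h
    exact h1 (treeAut_ext h)
  have hN' : ∀ k ∈ ggsGroup p, ∀ n ∈ N, ⁅n, k⁆ ∈ N := by
    intro k hk n hn
    rw [commutatorElement_def, mul_assoc, mul_assoc, ← mul_assoc k]
    exact mul_mem hn (hN k hk _ (inv_mem hn))
  refine ⟨_, levelKernel_le_of_atVertex hχ hp5 v hN fun r hr => ?_⟩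
  suffices ⁅affKernel χ, affKernel χ⁆ ≤ N.comap (atVertex v) from this hr
  rw [Subgroup.commutator_le]
  intro r hr s hs
  rw [Subgroup.mem_comap]
  have hrG := affKernel_le (atVertex_mem_affKernel hχ hp5 v (inv_mem hr))
  have hsG := affKernel_le (atVertex_mem_affKernel hχ hp5 v hs)
  obtain ⟨r', hr'⟩ := exists_conj_atVertex v r⁻¹ hg
  have h2 := hN' _ hsG _ (hN' _ hrG _ hgN)
  rw [commutatorElement_def g, hr', ← map_inv, inv_inv] at h2
  have hc : Commute (atVertex (g.1 v) r') (atVertex v ⁅r, s⁆) :=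
    atVertex_commute (g.2.1 v) hv _ _
  have : ⁅atVertex (g.1 v) r' * atVertex v r, atVertex v s⁆ = atVertex v ⁅r, s⁆ := by
    have hc' : Commute (atVertex (g.1 v) r') (atVertex v s) :=
      atVertex_commute (g.2.1 v) hv _ _
    calc _ = atVertex (g.1 v) r' * ⁅atVertex v r, atVertex v s⁆ *
          (atVertex v s * (atVertex (g.1 v) r')⁻¹ * (atVertex v s)⁻¹) := by
            simp only [commutatorElement_def]; group
      _ = _ := by
        rw [← hc'.inv_left.eq, mul_inv_cancel_right, ← map_commutatorElement, hc.eq,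
          mul_inv_cancel_right]
  rwa [this] at h2

/-- A subgroup normalized by the GGS-group that contains the `p ^ k`-th powers of its elements
contains a level stabilizer. -/
theorem exists_levelFixer_inf_le (hχ : IsCyclotomicChar χ) (hp5 : 5 ≤ p)
    {N : Subgroup (treeAut (ZMod p))} (hN : ∀ g ∈ ggsGroup p, ∀ n ∈ N, g * n * g⁻¹ ∈ N)
    {k : ℕ} (hk : ∀ g ∈ ggsGroup p, g ^ p ^ k ∈ N) :
    ∃ n, ggsGroup p ⊓ levelFixer (ZMod p) n ≤ N := by
  have hanti := levelFixer_antitone (ZMod p)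
  have hpow : ∀ n, ∀ g ∈ ggsGroup p,
      g ^ p ^ (max k n) ∈ N ∧ g ^ p ^ (max k n) ∈ levelFixer (ZMod p) n := by
    intro n g hg
    refine ⟨?_, hanti (le_max_right k n) (pow_mem_levelFixer _ hg)⟩
    rw [← Nat.add_sub_of_le (le_max_left k n), pow_add, pow_mul]
    exact pow_mem (hk g hg) _
  obtain ⟨m, hm⟩ : ∃ m, levelKernel χ m ≤ N := by
    obtain ⟨y, hy⟩ := exists_mem_graph_transl hχ 1
    have hyG := mem_ggsGroup.2 ⟨_, hy⟩
    refine exists_levelKernel_le hχ hp5 hN (pow_mem hyG (p ^ k)) (hk y hyG) fun h1 => ?_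
    have h2 := pow_mem hy (p ^ k)
    rw [Prod.pow_mk, h1, transl_pow] at h2
    have h3 := congrArg Aff.tr (eq_one_of_mem_graph hχ.sum_eq_zero h2)
    have := hχ.nontrivial
    exact one_ne_zero (eq_zero_of_pow_mul hχ k (by simpa [transl, Aff.tr_one] using h3))
  have hdown : ∃ n, levelKernel χ 0 ⊓ levelFixer (ZMod p) n ≤ N := by
    have hstart : ∃ n, levelKernel χ m ⊓ levelFixer (ZMod p) n ≤ N := ⟨0, inf_le_left.trans hm⟩
    clear hm
    induction m with
    | zero => exact hstart
    | succ m ih =>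
      obtain ⟨n, hn⟩ := hstart
      refine ih ⟨max n (p * max k n + 3 + m), fun g hg => ?_⟩
      obtain ⟨h, hh, hhg⟩ := exists_root_of_mem_levelKernel hχ hp5 (max k n) m hg.1
        (hanti (le_max_right _ _) hg.2)
      obtain ⟨h1, h2⟩ := hpow n h (affKernel_le (levelKernel_le hχ hp5 m hh))
      have h3 := hn ⟨hhg, Subgroup.mul_mem _ (Subgroup.inv_mem _ h2) (hanti (le_max_left _ _) hg.2)⟩
      simpa using mul_mem h1 h3
  obtain ⟨n, hn⟩ := hdown
  refine ⟨max n (p * max k n + 2), fun g hg => ?_⟩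
  obtain ⟨h, hh, hhg⟩ := exists_root hχ hp5 (max k n) hg.1 (hanti (le_max_right _ _) hg.2)
  obtain ⟨h1, h2⟩ := hpow n h hh
  have h3 := hn ⟨hhg, Subgroup.mul_mem _ (Subgroup.inv_mem _ h2) (hanti (le_max_left _ _) hg.2)⟩
  simpa using mul_mem h1 h3

end Congruence

/-! ### The cyclotomic rings -/

noncomputable section Cyclotomic

open Polynomial

variable (p : ℕ) [Fact p.Prime] (B : Type) [CommRing B]

/-- The ring obtained from `B` by adjoining a root of the `p`-th cyclotomic polynomial. -/
abbrev CycloRing : Type := AdjoinRoot (cyclotomic p B)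

omit [Fact p.Prime] in
lemma root_pow_prime : (AdjoinRoot.root (cyclotomic p B)) ^ p = 1 := by
  obtain ⟨q, hq⟩ := cyclotomic.dvd_X_pow_sub_one p B
  have := congrArg (AdjoinRoot.mk (cyclotomic p B)) hq
  rw [map_mul, AdjoinRoot.mk_self, zero_mul, map_sub, map_pow, AdjoinRoot.mk_X, map_one] at this
  exact sub_eq_zero.1 this

/-- The character with `1 ↦` the adjoined root. -/
def cycloChar : AddChar (ZMod p) (CycloRing p B) := AddChar.zmodChar p (root_pow_prime p B)

lemma cycloChar_natCast (n : ℕ) : cycloChar p B n = AdjoinRoot.root (cyclotomic p B) ^ n := by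
  exact AddChar.zmodChar_apply' _ n

lemma sum_cycloChar : ∑ x, cycloChar p B x = 0 := by
  rw [← sum_range_eq_sum_zmod]
  simp_rw [cycloChar_natCast]
  have := AdjoinRoot.mk_self (f := cyclotomic p B)
  rw [show AdjoinRoot.mk (cyclotomic p B) (cyclotomic p B) = AdjoinRoot.mk (cyclotomic p B)
    (∑ i ∈ Finset.range p, X ^ i) from congrArg _ (cyclotomic_prime B p), map_sum] at this
  simpa using this

lemma nontrivial_cycloRing [IsDomain B] : Nontrivial (CycloRing p B) :=
  AdjoinRoot.nontrivial _ (degree_cyclotomic_pos p B (Fact.out : p.Prime).pos).ne'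

lemma isCyclotomicChar_cycloChar : IsCyclotomicChar (cycloChar p ℤ) where
  sum_eq_zero := sum_cycloChar p ℤ
  closure_range := by
    rw [eq_top_iff]
    rintro t -
    obtain ⟨q, rfl⟩ := AdjoinRoot.mk_surjective t
    induction q using Polynomial.induction_on' with
    | add q r hq hr => rw [map_add]; exact add_mem hq hr
    | monomial n c =>
      have : AdjoinRoot.mk (cyclotomic p ℤ) (monomial n c) = c • cycloChar p ℤ n := by
        rw [cycloChar_natCast, ← C_mul_X_pow_eq_monomial, map_mul, map_pow, AdjoinRoot.mk_X,
          zsmul_eq_mul]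
        simp
      rw [this]
      exact zsmul_mem (AddSubgroup.subset_closure (Set.mem_range_self _)) _
  eq_of_sum_eq_zero := by
    intro n hn
    have hp : p.Prime := Fact.out
    set c := n ((p - 1 : ℕ) : ZMod p)
    set q : ℤ[X] := ∑ i ∈ Finset.range p, C (n i - c) * X ^ i with hq
    have hcoeff : ∀ m, q.coeff m = if m < p then n m - c else 0 := by
      intro m
      simp only [hq, finsetSum_coeff, coeff_C_mul, coeff_X_pow]
      simp
    have hmk : AdjoinRoot.mk (cyclotomic p ℤ) q = 0 := by
      rw [hq, map_sum]
      have : ∀ i ∈ Finset.range p, AdjoinRoot.mk (cyclotomic p ℤ) (C (n i - c) * X ^ i) =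
          n i * cycloChar p ℤ i - c * cycloChar p ℤ i := by
        intro i _
        rw [map_mul, map_pow, AdjoinRoot.mk_X, cycloChar_natCast, ← sub_mul]
        simp
      rw [Finset.sum_congr rfl this, Finset.sum_sub_distrib, ← Finset.mul_sum,
        sum_range_eq_sum_zmod (fun x => (n x : CycloRing p ℤ) * cycloChar p ℤ x),
        sum_range_eq_sum_zmod (fun x => cycloChar p ℤ x), hn, sum_cycloChar]
      simp
    have hq0 : q = 0 := by
      refine eq_zero_of_dvd_of_degree_lt (AdjoinRoot.mk_eq_zero.1 hmk) ?_
      rw [degree_cyclotomic, Nat.totient_prime hp, degree_lt_iff_coeff_zero]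
      intro m hm
      rw [hcoeff]
      split_ifs with h
      · obtain rfl : m = p - 1 := by omega
        exact sub_self _
      · rfl
    have hall : ∀ x, n x = c := by
      intro x
      have := hcoeff x.val
      rw [hq0, if_pos x.val_lt, ZMod.natCast_zmod_val] at this
      exact (sub_eq_zero.1 this.symm)
    exact fun x => (hall x).trans (hall 0).symm
  eq_zero_of_natCast_mul := by
    intro s hs
    have hp : p.Prime := Fact.out
    have := AdjoinRoot.isDomain_of_prime (cyclotomic.irreducible hp.pos).prime
    refine (mul_eq_zero.1 hs).resolve_left fun h0 => ?_
    have h1 : AdjoinRoot.mk (cyclotomic p ℤ) (C (p : ℤ)) = 0 := by simpa using h0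
    have h2 := eq_zero_of_dvd_of_degree_lt (AdjoinRoot.mk_eq_zero.1 h1)
      (degree_C_le.trans_lt (degree_cyclotomic_pos p ℤ hp.pos))
    rw [C_eq_zero] at h2
    exact hp.ne_zero (by exact_mod_cast h2)
  nontrivial := nontrivial_cycloRing p ℤ

omit [Fact p.Prime] in
lemma finite_cycloRing [Finite B] : Finite (CycloRing p B) := by
  have := (AdjoinRoot.powerBasis' (cyclotomic.monic p B)).finite
  exact Module.finite_of_finite B

end Cyclotomic

/-! ### Congruence subgroup properties -/

lemma quotientMap_id_map_id {G : Type} [Group G] {N M K : Subgroup G} [N.Normal] [M.Normal]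
    [K.Normal] (hNM : N ≤ M) (hMK : M ≤ K) (x : G ⧸ N) :
    QuotientGroup.map M K (MonoidHom.id G) hMK (QuotientGroup.map N M (MonoidHom.id G) hNM x) =
      QuotientGroup.map N K (MonoidHom.id G) (hNM.trans hMK) x := by
  induction x using QuotientGroup.induction_on with
  | H g => rfl

/-- If all level stabilizers have quotients in `C`, the congruence subgroup property makes the
canonical map of completions bijective. -/
lemma HasCSP.bijective_proToCongruence {X : Type} [Inhabited X] {C : GroupClass}
    {G : Subgroup (treeAut X)} (h : HasCSP C G) (hC : ∀ n, C (G ⧸ levelStabilizer G n)) :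
    Function.Bijective (proToCongruence hC) := by
  have hanti : Antitone (levelStabilizer G) := fun m n hmn _ hg =>
    levelFixer_antitone X hmn hg
  choose n hn using fun N : ClassSubgroup C G => h N.toSubgroup N.quotient_mem
  constructor
  · intro x y hxy
    refine Subtype.ext (funext fun N => ?_)
    have hx := x.2 ⟨levelStabilizer G (n N), inferInstance, hC _⟩ N (hn N)
    have hy := y.2 ⟨levelStabilizer G (n N), inferInstance, hC _⟩ N (hn N)
    rw [← hx, ← hy]
    exact congrArg _ (congrFun (congrArg Subtype.val hxy) (n N))
  · intro y
    have hmap : ∀ (N : Subgroup G) [N.Normal] (i j : ℕ) (hi : levelStabilizer G i ≤ N)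
        (hj : levelStabilizer G j ≤ N),
        QuotientGroup.map _ N (MonoidHom.id G) hi (y.1 i) =
          QuotientGroup.map _ N (MonoidHom.id G) hj (y.1 j) := by
      intro N _ i j hi hj
      rw [← y.2 (max i j) i (hanti (le_max_left i j)), ← y.2 (max i j) j (hanti (le_max_right i j))]
      exact (quotientMap_id_map_id _ hi _).trans (quotientMap_id_map_id _ hj _).symm
    refine ⟨⟨fun N => QuotientGroup.map _ N.toSubgroup (MonoidHom.id G) (hn N) (y.1 (n N)), ?_⟩, ?_⟩
    · intro N M hNM
      exact (quotientMap_id_map_id (hn N) hNM _).trans (hmap M.toSubgroup _ _ _ _)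
    · refine Subtype.ext (funext fun m => ?_)
      refine (hmap (levelStabilizer G m) _ m (hn _) le_rfl).trans ?_
      exact y.2 m m le_rfl

lemma finite_quotient_levelStabilizer {X : Type} [Finite X] (G : Subgroup (treeAut X)) (n : ℕ) :
    Finite (G ⧸ levelStabilizer G n) := by
  have hfin : Finite {v : List X // v.length = n} := inferInstanceAs (Finite (List.Vector X n))
  refine Finite.of_injective (β := {v : List X // v.length = n} → {v : List X // v.length = n})
    (fun q v => ⟨(q.out : treeAut X).1 v.1, by rw [(q.out : treeAut X).2.1, v.2]⟩) ?_
  intro q r hqr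
  rw [← q.out_eq', ← r.out_eq', QuotientGroup.eq, mem_levelStabilizer]
  intro v hv
  have : (q.out : treeAut X).1 v = (r.out : treeAut X).1 v :=
    congrArg Subtype.val (congrFun hqr ⟨v, hv⟩)
  change ((q.out : treeAut X)⁻¹ * (r.out : treeAut X)).1 v = v
  rw [treeAut_mul_apply, ← this, ← treeAut_mul_apply, inv_mul_cancel, treeAut_one_apply]

section GGS

variable {p : ℕ} [Fact p.Prime]

lemma finitePGroups_quotient (n : ℕ) :
    finitePGroups p (ggsGroup p ⧸ levelStabilizer (ggsGroup p) n) := by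
  refine ⟨finite_quotient_levelStabilizer _ n, fun q => ⟨n, ?_⟩⟩
  induction q using QuotientGroup.induction_on with
  | H g =>
    rw [← QuotientGroup.mk_pow, QuotientGroup.eq_one_iff, mem_levelStabilizer]
    exact pow_mem_levelFixer n g.2

theorem hasCSP_finitePGroups (hp5 : 5 ≤ p) : HasCSP (finitePGroups p) (ggsGroup p) := by
  intro N _ hN
  obtain ⟨hfin, hpg⟩ := hN
  obtain ⟨k, hk⟩ := IsPGroup.iff_card.1 hpg
  have hconj : ∀ g ∈ ggsGroup p, ∀ n ∈ N.map (ggsGroup p).subtype,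
      g * n * g⁻¹ ∈ N.map (ggsGroup p).subtype := by
    rintro g hg _ ⟨n, hn, rfl⟩
    exact ⟨_, Subgroup.Normal.conj_mem inferInstance n hn ⟨g, hg⟩, rfl⟩
  have hpow : ∀ g ∈ ggsGroup p, g ^ p ^ k ∈ N.map (ggsGroup p).subtype := by
    intro g hg
    refine ⟨(⟨g, hg⟩ : ggsGroup p) ^ p ^ k, ?_, rfl⟩
    rw [SetLike.mem_coe, ← QuotientGroup.eq_one_iff, QuotientGroup.mk_pow, ← hk, pow_card_eq_one']
  obtain ⟨n, hn⟩ := exists_levelFixer_inf_le (isCyclotomicChar_cycloChar p) hp5 hconj hpow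
  refine ⟨n, fun g hg => ?_⟩
  obtain ⟨g', hg', h⟩ := hn ⟨g.2, hg⟩
  rwa [← Subtype.ext h]

instance normal_affKernel {O : Type} [CommRing O] (χ : AddChar (ZMod p) O) :
    ((affKernel χ).subgroupOf (ggsGroup p)).Normal where
  conj_mem := by
    rintro n hn g
    obtain ⟨w, hw⟩ := mem_ggsGroup (χ := χ).1 g.2
    have := mul_mem (mul_mem hw (mem_affKernel.1 hn)) (inv_mem hw)
    rw [Prod.mk_mul_mk, Prod.inv_mk, Prod.mk_mul_mk, mul_one, mul_inv_cancel] at this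
    exact this

lemma finite_quotient_affKernel {O : Type} [CommRing O] [Finite O] (χ : AddChar (ZMod p) O) :
    Finite (ggsGroup p ⧸ (affKernel χ).subgroupOf (ggsGroup p)) := by
  have : Finite (Aff χ) := Finite.of_injective (fun u => (u.lin, u.tr)) fun u v h =>
    Aff.ext (congrArg Prod.fst h) (congrArg Prod.snd h)
  choose w hw using fun g : ggsGroup p => mem_ggsGroup (χ := χ).1 g.2
  refine Finite.of_injective (fun q => w q.out) fun q r hqr => ?_
  rw [← q.out_eq', ← r.out_eq', QuotientGroup.eq, Subgroup.mem_subgroupOf, mem_affKernel]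
  have h := mul_mem (inv_mem (hw q.out)) (hw r.out)
  change w q.out = w r.out at hqr
  rwa [hqr, Prod.inv_mk, Prod.mk_mul_mk, inv_mul_cancel] at h

theorem not_hasCSP_finiteGroups (hp2 : p ≠ 2) : ¬ HasCSP finiteGroups (ggsGroup p) := by
  intro h
  set χ := cycloChar p (ZMod 2)
  have hχ : ∑ x, χ x = 0 := sum_cycloChar p (ZMod 2)
  have := finite_cycloRing p (ZMod 2)
  have := nontrivial_cycloRing p (ZMod 2)
  obtain ⟨n, hn⟩ := h ((affKernel χ).subgroupOf (ggsGroup p)) (finite_quotient_affKernel χ)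
  have hy : ((transPair χ 0).1, transl χ 1) ∈ graph χ := by
    have := transPair_mem (χ := χ) 0
    rwa [← Prod.mk.eta (p := transPair χ 0), transPair_snd, AddChar.map_zero_eq_one] at this
  have hyG := mem_ggsGroup.2 ⟨_, hy⟩
  have h1 : (transPair χ 0).1 ^ p ^ n ∈ affKernel χ :=
    hn (x := ⟨_, pow_mem hyG (p ^ n)⟩) (pow_mem_levelFixer n hyG)
  have h2 := congrArg Aff.tr (graph_unique hχ (pow_mem hy (p ^ n)) h1)
  change (transl χ 1 ^ p ^ n).tr = 0 at h2
  rw [transl_pow, mul_one] at h2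
  change ((p ^ n : ℕ) : CycloRing p (ZMod 2)) = 0 at h2
  obtain ⟨m, hm⟩ := ((Fact.out : p.Prime).odd_of_ne_two hp2).pow (n := n)
  have h3 : (2 : CycloRing p (ZMod 2)) = 0 := by
    have : ((2 : ℕ) : ZMod 2) = 0 := rfl
    have := congrArg (algebraMap (ZMod 2) (CycloRing p (ZMod 2))) this
    rwa [map_natCast, map_zero, Nat.cast_two] at this
  rw [hm, Nat.cast_add, Nat.cast_mul, Nat.cast_two, h3, zero_mul, zero_add, Nat.cast_one] at h2
  exact one_ne_zero h2

end GGS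

theorem mainTheorem3 (p : ℕ) (hp : p.Prime) (hp5 : 5 ≤ p) :
    HasCSP (finitePGroups p) (ggsGroup p) ∧
    (∃ hC : ∀ n, finitePGroups p (ggsGroup p ⧸ levelStabilizer (ggsGroup p) n),
      Function.Bijective (proToCongruence hC)) ∧
    ¬ HasCSP finiteGroups (ggsGroup p) := by
  have : Fact p.Prime := ⟨hp⟩
  exact ⟨hasCSP_finitePGroups hp5, ⟨finitePGroups_quotient,
    (hasCSP_finitePGroups hp5).bijective_proToCongruence _⟩, not_hasCSP_finiteGroups (by omega)⟩
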